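/- Let $A$ be a free group of rank $n\ge 2$ with free basis $a_1,\dots,a_n$, let $T$ be the Cayley graph of $A$ with respect to this basis, regarded as a metric tree with edges of length $1$, let $B$ be a group and $\varphi:A\to\mathrm{Aut}(B)$ a homomorphism. Suppose that $G=B\rtimes_\varphi A$ is finitely generated, and let $\rho:G\to\mathrm{Isom}(T)$ be the action obtained by composing the projection $G\to A$ with the left translation action of $A$ on $T$. For a geodesic ray $\tau:[0,\infty)\to T$ and $t\in\mathbb R$, let $HB_t(\tau)=\bigcup_{l\ge\max\{0,t\}}\overline{\mathrm{Ball}}_{\,l-t}(\tau(l))$. The boundary $\partial T$ is the set of geodesic rays up to bounded distance, and $\tau(\infty)$ is the class of $\tau$. The set $\Sigma^1(\rho)\subseteq\partial T$ consists of the endpoints $e=\tau(\infty)$ over which $\rho$ is controlled connected: given a contractible free $G$-CW-complex $\tilde X$ (the universal cover of a $K(G,1)$) whose $1$-skeleton $\tilde X^{(1)}$ is cocompact and a continuous $G$-map $h:\tilde X^{(1)}\to T$, let $\tilde X_{(\tau,t)}$ be the largest subcomplex of $\tilde X^{(1)}$ contained in $h^{-1}(HB_t(\tau))$; then there is a function $\lambda:\mathbb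 R\to[0,\infty)$ with $t-\lambda(t)\to\infty$ as $t\to\infty$ such that, for all $t\in\mathbb R$, any two points of $\tilde X_{(\tau,t)}$ are joined by a path in $\tilde X_{(\tau,t-\lambda(t))}$. (This property does not depend on the choice of $\tilde X$, $h$ and $\tau$; it is required here for every choice.) If $\varphi(A)\le\mathrm{Aut}(B)$ is abelian, then $\Sigma^1(\rho)$ is nonempty. Moreover, if an endpoint $e\in\partial T$ is represented by an infinite freely reduced word $c_0c_1c_2\cdots$ in the letters $a_i^{\pm1}$ (that is, $e$ is the end of the geodesic ray with vertices $1,\,c_0,\,c_0c_1,\dots$), and infinitely many nonempty subwords $c_pc_{p+1}\cdots c_{p+l-1}$ of it, told apart by their positions $(p,l)$, spell commutators of elements of $A$, then $e\in\Sigma^1(\rho)$. -/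

import Mathlib

open Topology Set

open scoped NNReal

universe u v w

noncomputable section

/-! ## Controlled connectivity and the invariant `Σ¹` of an isometric action -/

/-- A geodesic ray in a metric space: an isometric embedding of `[0, ∞)`. -/
structure GeodesicRay (M : Type v) [MetricSpace M] where
  toFun : ℝ≥0 → M
  isometry : Isometry toFun

namespace GeodesicRay

variable {M : Type v} [MetricSpace M]

instance : CoeFun (GeodesicRay M) (fun _ => ℝ≥0 → M) := ⟨GeodesicRay.toFun⟩

/-- Two geodesic rays are asymptotic if they stay at bounded distance from each other. -/
instance asymptotic (M : Type v) [MetricSpace M] : Setoid (GeodesicRay M) where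
  r τ σ := ∃ C : ℝ, ∀ t, dist (τ t) (σ t) ≤ C
  iseqv :=
    { refl := fun τ => ⟨0, fun t => by simp⟩
      symm := fun ⟨C, h⟩ => ⟨C, fun t => by rw [dist_comm]; exact h t⟩
      trans := fun ⟨C, h⟩ ⟨D, k⟩ =>
        ⟨C + D, fun t => (dist_triangle _ _ _).trans (add_le_add (h t) (k t))⟩ }

/-- The horoball `HB_k(τ)` at the end of the ray `τ`: the nested union of the closed balls of
radius `l - k` about `τ(l)`, over `l ≥ max {0, k}`. It shrinks towards the end as `k` grows. -/
def horoball (τ : GeodesicRay M) (k : ℝ) : Set M :=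
  {x | ∃ l : ℝ≥0, k ≤ l ∧ dist x (τ l) ≤ l - k}

end GeodesicRay

/-- The boundary `∂M`: the geodesic rays of `M` up to asymptoticity. -/
def GeodesicBoundary (M : Type v) [MetricSpace M] : Type v :=
  Quotient (GeodesicRay.asymptotic M)

/-- The endpoint `τ(∞)` of a geodesic ray. -/
def GeodesicRay.endpoint {M : Type v} [MetricSpace M] (τ : GeodesicRay M) : GeodesicBoundary M :=
  Quotient.mk _ τ

/-- `X` is a contractible free `G`-CW-complex, i.e. the universal cover of a `K(G, 1)`-complex:
`G` acts by homeomorphisms that permute the open cells, and no nontrivial element maps a cell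
to itself. -/
structure IsContractibleFreeGCW (G : Type u) [Group G] (X : Type w) [TopologicalSpace X]
    [T2Space X] [CWComplex (univ : Set X)] [MulAction G X] : Prop where
  contractible : ContractibleSpace X
  continuous_smul : ∀ g : G, Continuous fun x : X => g • x
  map_cell : ∀ (g : G) (n : ℕ) (i : RelCWComplex.cell (univ : Set X) n),
    ∃ j : RelCWComplex.cell (univ : Set X) n,
      (fun x => g • x) '' RelCWComplex.openCell n i = RelCWComplex.openCell n j
  free : ∀ (g : G) (n : ℕ) (i : RelCWComplex.cell (univ : Set X) n),
    (fun x => g • x) '' RelCWComplex.openCell n i = RelCWComplex.openCell n i → g = 1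

/-- The `1`-skeleton of `X` is cocompact: there are finitely many `G`-orbits of cells of
dimension `0` and `1`. -/
def HasCocompactOneSkeleton (G : Type u) [Group G] (X : Type w) [TopologicalSpace X]
    [T2Space X] [CWComplex (univ : Set X)] [MulAction G X] : Prop :=
  ∀ n : ℕ, n ≤ 1 → ∃ F : Set (RelCWComplex.cell (univ : Set X) n), F.Finite ∧
    ∀ i : RelCWComplex.cell (univ : Set X) n, ∃ j ∈ F, ∃ g : G,
      (fun x => g • x) '' RelCWComplex.openCell n j = RelCWComplex.openCell n i

/-- The `1`-skeleton `X^(1)`, as a set of points of `X`. -/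
def oneSkeleton (X : Type w) [TopologicalSpace X] [T2Space X] [CWComplex (univ : Set X)] :
    Set X :=
  (RelCWComplex.skeleton (univ : Set X) 1 : Set X)

/-- `h` restricts to a continuous `G`-map from the `1`-skeleton of `X` to `M`, where `G` acts on
`M` through `ρ`. The values of `h` off the `1`-skeleton are irrelevant. -/
structure IsControlMap {G : Type u} [Group G] {M : Type v} [MetricSpace M]
    (ρ : G →* (M ≃ᵢ M)) {X : Type w} [TopologicalSpace X] [T2Space X]
    [CWComplex (univ : Set X)] [MulAction G X] (h : X → M) : Prop where
  continuousOn : ContinuousOn h (oneSkeleton X)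
  equivariant : ∀ (g : G), ∀ x ∈ oneSkeleton X, h (g • x) = ρ g (h x)

/-- `X_(τ,t)`: the largest subcomplex of the `1`-skeleton which `h` maps into `HB_t(τ)`,
written as the union of all such subcomplexes. -/
def horoPreimage {M : Type v} [MetricSpace M] {X : Type w} [TopologicalSpace X] [T2Space X]
    [CWComplex (univ : Set X)] (h : X → M) (τ : GeodesicRay M) (t : ℝ) : Set X :=
  {x | ∃ E : RelCWComplex.Subcomplex (univ : Set X),
    (E : Set X) ⊆ oneSkeleton X ∧ (E : Set X) ⊆ h ⁻¹' τ.horoball t ∧ x ∈ (E : Set X)}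

/-- `h` is controlled connected over `τ(∞)`: there is a lag `λ` with `t - λ(t) → ∞` as `t → ∞`
such that any two points of `X_(τ,t)` are joined by a path in `X_(τ,t-λ(t))`. -/
def ControlledConnected {M : Type v} [MetricSpace M] {X : Type w} [TopologicalSpace X]
    [T2Space X] [CWComplex (univ : Set X)] (h : X → M) (τ : GeodesicRay M) : Prop :=
  ∃ lag : ℝ → ℝ≥0,
    (∀ t : ℝ, ∀ x ∈ horoPreimage h τ t, ∀ y ∈ horoPreimage h τ t,
      JoinedIn (horoPreimage h τ (t - lag t)) x y) ∧
    Filter.Tendsto (fun t : ℝ => t - lag t) Filter.atTop Filter.atTop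

/-- The invariant `Σ¹(ρ)` of an isometric action `ρ` of a finitely generated group `G` on `M`:
the set of endpoints over which `ρ` is controlled connected. Controlled connectivity is
independent of the choice of the complex `X`, of the `G`-map `h` and of the ray representing the
endpoint, and such choices exist as `G` is finitely generated; we ask for it for every choice. -/
def SigmaOne.{w', u', v'} {G : Type u'} [Group G] {M : Type v'} [MetricSpace M]
    (ρ : G →* (M ≃ᵢ M)) : Set (GeodesicBoundary M) :=
  {e | ∀ (X : Type w') [TopologicalSpace X] [T2Space X] [CWComplex (univ : Set X)]
      [MulAction G X] (h : X → M) (τ : GeodesicRay M),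
      IsContractibleFreeGCW G X → HasCocompactOneSkeleton G X → IsControlMap ρ h →
      τ.endpoint = e → ControlledConnected h τ}

/-! ## The metric realization of a connected graph -/

namespace SimpleGraph

variable {V : Type u}

open Classical in
/-- The segment between the vertices `x` and `y`, in barycentric coordinates. -/
def realizedEdge (x y : V) : Set (V → ℝ) :=
  segment ℝ (Pi.single x 1) (Pi.single y 1)

/-- The geometric realization of a graph, in barycentric coordinates: the union of its vertices
and edges. -/
def Realization (Γ : SimpleGraph V) : Type u :=
  {p : V → ℝ // ∃ x y, (x = y ∨ Γ.Adj x y) ∧ p ∈ realizedEdge x y}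

namespace Realization

variable {Γ : SimpleGraph V}

open Classical in
/-- A vertex, as a point of the realization. -/
def vertex (Γ : SimpleGraph V) (x : V) : Γ.Realization :=
  ⟨Pi.single x 1, x, x, Or.inl rfl, left_mem_segment ℝ _ _⟩

/-- `IsString p q ℓ`: some string of points from `p` to `q`, any two consecutive points of which
lie on a common edge, has length `ℓ`. Each edge has length `1`. -/
inductive IsString : Γ.Realization → Γ.Realization → ℝ → Prop
  | nil (p : Γ.Realization) : IsString p p 0
  | cons {p q r : Γ.Realization} {x y : V} {ℓ : ℝ} (hxy : Γ.Adj x y)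
      (hp : p.1 ∈ realizedEdge x y) (hq : q.1 ∈ realizedEdge x y) (hqr : IsString q r ℓ) :
      IsString p r (|p.1 x - q.1 x| + ℓ)

open Classical in
theorem realizedEdge_apply {x y : V} (hxy : x ≠ y) {p : V → ℝ} (hp : p ∈ realizedEdge x y) :
    p y = 1 - p x ∧ ∀ z, z ≠ x → z ≠ y → p z = 0 := by
  obtain ⟨s, t, _, _, hst, rfl⟩ := hp
  refine ⟨?_, fun z hzx hzy => by simp [hzx, hzy]⟩
  simp [hxy, hxy.symm]
  linarith

theorem realizedEdge_dist {x y : V} (hxy : x ≠ y) {p q : V → ℝ} (hp : p ∈ realizedEdge x y)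
    (hq : q ∈ realizedEdge x y) (z : V) : |p z - q z| ≤ |p x - q x| := by
  obtain ⟨h1, h2⟩ := realizedEdge_apply hxy hp
  obtain ⟨k1, k2⟩ := realizedEdge_apply hxy hq
  by_cases hzx : z = x
  · rw [hzx]
  by_cases hzy : z = y
  · rw [hzy, h1, k1, abs_sub_comm (p x)]
    exact le_of_eq (congrArg _ (by ring))
  · rw [h2 z hzx hzy, k2 z hzx hzy]
    simp

theorem IsString.abs_sub_le {p q : Γ.Realization} {ℓ : ℝ} (h : IsString p q ℓ) (z : V) :
    |p.1 z - q.1 z| ≤ ℓ := by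
  induction h with
  | nil p => simp
  | cons hxy hp hq _ ih =>
    exact (_root_.abs_sub_le _ _ _).trans (add_le_add (realizedEdge_dist hxy.ne hp hq z) ih)

theorem IsString.nonneg {p q : Γ.Realization} {ℓ : ℝ} (h : IsString p q ℓ) : 0 ≤ ℓ := by
  induction h with
  | nil p => exact le_rfl
  | cons _ _ _ _ ih => positivity

theorem IsString.append {p q r : Γ.Realization} {ℓ m : ℝ} (h : IsString p q ℓ)
    (k : IsString q r m) : IsString p r (ℓ + m) := by
  induction h with
  | nil p => simpa using k
  | cons hxy hp hq _ ih =>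
    rw [add_assoc]
    exact .cons hxy hp hq (ih k)

theorem IsString.symm {p q : Γ.Realization} {ℓ : ℝ} (h : IsString p q ℓ) : IsString q p ℓ := by
  induction h with
  | nil p => exact .nil p
  | cons hxy hp hq _ ih =>
    have := ih.append (.cons hxy hq hp (.nil _))
    rwa [abs_sub_comm, add_zero, add_comm] at this

open Classical in
theorem exists_isString_vertex (p : Γ.Realization) : ∃ x ℓ, IsString p (vertex Γ x) ℓ := by
  obtain ⟨x, y, hxy, hp⟩ := p.2
  rcases hxy with rfl | hxy
  · have : p = vertex Γ x := by
      apply Subtype.ext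
      simpa [realizedEdge, vertex] using hp
    exact ⟨x, 0, this ▸ .nil _⟩
  · exact ⟨x, _, .cons hxy hp (left_mem_segment ℝ _ _) (.nil _)⟩

open Classical in
theorem exists_isString (hΓ : Γ.Connected) (p q : Γ.Realization) : ∃ ℓ, IsString p q ℓ := by
  obtain ⟨x, ℓ, hx⟩ := exists_isString_vertex p
  obtain ⟨y, m, hy⟩ := exists_isString_vertex q
  obtain ⟨W⟩ := hΓ.preconnected x y
  have : ∀ {x y : V}, Γ.Walk x y → ∃ k, IsString (vertex Γ x) (vertex Γ y) k := by
    intro x y W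
    induction W with
    | nil => exact ⟨0, .nil _⟩
    | cons hxy _ ih =>
      obtain ⟨k, hk⟩ := ih
      exact ⟨_, .cons hxy (left_mem_segment ℝ _ _) (right_mem_segment ℝ _ _) hk⟩
  obtain ⟨k, hk⟩ := this W
  exact ⟨_, (hx.append hk).append hy.symm⟩

/-- The length metric on the realization of a connected graph: the distance of two points is the
infimum of the lengths of the strings joining them. -/
instance [hΓ : Fact Γ.Connected] : MetricSpace Γ.Realization where
  dist p q := sInf {ℓ | IsString p q ℓ}
  dist_self p := le_antisymm (csInf_le ⟨0, fun _ h => h.nonneg⟩ (.nil p))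
    (Real.sInf_nonneg fun _ h => h.nonneg)
  dist_comm p q := congrArg sInf (Set.ext fun _ => ⟨IsString.symm, IsString.symm⟩)
  dist_triangle p q r := by
    refine le_of_forall_pos_le_add fun ε hε => ?_
    obtain ⟨ℓ, hℓ, h1⟩ := Real.lt_sInf_add_pos (exists_isString hΓ.out p q) (half_pos hε)
    obtain ⟨m, hm, h2⟩ := Real.lt_sInf_add_pos (exists_isString hΓ.out q r) (half_pos hε)
    have h3 : sInf {k | IsString p r k} ≤ ℓ + m :=
      csInf_le ⟨0, fun _ h => h.nonneg⟩ (IsString.append hℓ hm)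
    have h4 : sInf {k | IsString p r k} ≤
        sInf {k | IsString p q k} + sInf {k | IsString q r k} + ε := by
      change _ ≤ sInf (IsString p q) + sInf (IsString q r) + ε
      linarith
    exact h4
  eq_of_dist_eq_zero := by
    intro p q h
    refine Subtype.ext (funext fun z => ?_)
    have h1 : |p.1 z - q.1 z| ≤ sInf {ℓ | IsString p q ℓ} :=
      le_csInf (exists_isString hΓ.out p q) fun _ h => h.abs_sub_le z
    have h2 : |p.1 z - q.1 z| ≤ 0 := h1.trans h.le
    exact sub_eq_zero.1 (abs_nonpos_iff.1 h2)

theorem dist_def [Fact Γ.Connected] (p q : Γ.Realization) :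
    Dist.dist p q = sInf {ℓ | IsString p q ℓ} := rfl

end Realization

end SimpleGraph

/-! ## The Cayley tree of a free group and the action on it -/

section CayleyTree

open SimpleGraph

variable {A : Type u} [Group A] {n : ℕ}

instance cayleyGraph_connected (a : FreeGroupBasis (Fin n) A) :
    Fact (mulCayley (Set.range a)).Connected := by
  have key : ∀ x : FreeGroup (Fin n), ∀ b : A,
      (mulCayley (Set.range a)).Reachable b (b * a.repr.symm x) := by
    have step : ∀ (i : Fin n) (b : A), (mulCayley (Set.range a)).Reachable b (b * a i) := by
      intro i b
      by_cases h : b = b * a i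
      · rw [← h]
      · exact Adj.reachable ((mulCayley_adj' _ _ _).2 ⟨h, a i, ⟨i, rfl⟩, Or.inl rfl⟩)
    intro x
    induction x using FreeGroup.induction_on with
    | C1 => intro b; simp
    | of i => exact step i
    | inv_of i _ =>
      intro b
      have := step i (b * (a i)⁻¹)
      rw [inv_mul_cancel_right] at this
      rw [map_inv]
      exact this.symm
    | mul x y hx hy =>
      intro b
      rw [map_mul, ← mul_assoc]
      exact (hx b).trans (hy _)
  refine ⟨⟨fun b c => ?_⟩⟩
  have := key (a.repr (b⁻¹ * c)) b
  simpa using this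

/-- The Cayley graph of `A` with respect to the free basis `a`, as a metric tree with edges of
length `1`; its vertices are the elements of `A`, and `b` is joined to `b * a i`. -/
abbrev CayleyTree (a : FreeGroupBasis (Fin n) A) : Type u :=
  (mulCayley (Set.range a)).Realization

namespace CayleyTree

variable (a : FreeGroupBasis (Fin n) A)

theorem translate_mem (g : A) {x y : A} {p : A → ℝ} (hp : p ∈ realizedEdge x y) :
    (fun z => p (g⁻¹ * z)) ∈ realizedEdge (g * x) (g * y) := by
  classical
  obtain ⟨s, t, hs, ht, hst, rfl⟩ := hp
  refine ⟨s, t, hs, ht, hst, funext fun z => ?_⟩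
  simp [Pi.single_apply, inv_mul_eq_iff_eq_mul]

theorem adj_translate (g : A) {x y : A} (h : (mulCayley (Set.range a)).Adj x y) :
    (mulCayley (Set.range a)).Adj (g * x) (g * y) := by
  rw [mulCayley_adj'] at h ⊢
  obtain ⟨hne, s, hs, h⟩ := h
  refine ⟨fun h => hne (mul_left_cancel h), s, hs, ?_⟩
  rcases h with rfl | rfl
  · exact Or.inl (mul_assoc _ _ _)
  · exact Or.inr (mul_assoc _ _ _).symm

/-- Left translation by `g ∈ A` on the Cayley tree; it maps the vertex `b` to the vertex `g * b`
and is affine on edges. -/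
def translate (g : A) (p : CayleyTree a) : CayleyTree a :=
  ⟨fun z => p.1 (g⁻¹ * z), by
    obtain ⟨x, y, hxy, hp⟩ := p.2
    exact ⟨g * x, g * y, hxy.imp (congrArg _) (adj_translate a g), translate_mem g hp⟩⟩

theorem translate_vertex (g b : A) :
    translate a g (Realization.vertex _ b) = Realization.vertex _ (g * b) := by
  classical
  refine Subtype.ext (funext fun z => ?_)
  simp [translate, Realization.vertex, Pi.single_apply, inv_mul_eq_iff_eq_mul]

theorem translate_translate (g k : A) (p : CayleyTree a) :
    translate a g (translate a k p) = translate a (g * k) p :=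
  Subtype.ext (funext fun z => by simp [translate, mul_assoc])

theorem translate_one (p : CayleyTree a) : translate a 1 p = p :=
  Subtype.ext (funext fun z => by simp [translate])

theorem isString_translate (g : A) {p q : CayleyTree a} {ℓ : ℝ}
    (h : Realization.IsString p q ℓ) :
    Realization.IsString (translate a g p) (translate a g q) ℓ := by
  induction h with
  | nil p => exact .nil _
  | @cons p q r x y ℓ hxy hp hq _ ih =>
    have := Realization.IsString.cons (p := translate a g p) (q := translate a g q)
      (adj_translate a g hxy) (translate_mem g hp) (translate_mem g hq) ih
    simpa [translate] using this

theorem dist_translate (g : A) (p q : CayleyTree a) :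
    dist (translate a g p) (translate a g q) = dist p q := by
  refine congrArg sInf (Set.ext fun ℓ => ⟨fun h => ?_, isString_translate a g⟩)
  have := isString_translate a g⁻¹ h
  simpa [translate_translate, translate_one] using this

/-- The action of `A` on its Cayley tree by left translation. -/
def action : A →* (CayleyTree a ≃ᵢ CayleyTree a) where
  toFun g :=
    { toFun := translate a g
      invFun := translate a g⁻¹
      left_inv := fun p => by simp [translate_translate, translate_one]
      right_inv := fun p => by simp [translate_translate, translate_one]
      isometry_toFun := Isometry.of_dist_eq (dist_translate a g) }
  map_one' := IsometryEquiv.ext fun p => translate_one a p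
  map_mul' g k := IsometryEquiv.ext fun p => (translate_translate a g k p).symm

/-- The action `ρ` of `G = B ⋊ A` on the Cayley tree of `A`, through the projection `G → A`. -/
def semidirectAction {B : Type v} [Group B] (φ : A →* MulAut B) :
    (B ⋊[φ] A) →* (CayleyTree a ≃ᵢ CayleyTree a) :=
  (action a).comp SemidirectProduct.rightHom

end CayleyTree

/-- The element of `A` given by a letter: `(i, true)` stands for `a i` and `(i, false)` for
`(a i)⁻¹`. -/
def letterValue (a : FreeGroupBasis (Fin n) A) (s : Fin n × Bool) : A :=
  if s.2 then a s.1 else (a s.1)⁻¹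

/-- An infinite word is freely reduced if no letter is followed by its inverse. -/
def IsReducedInfiniteWord (c : ℕ → Fin n × Bool) : Prop :=
  ∀ m, c (m + 1) ≠ ((c m).1, !(c m).2)

/-- The element of `A` spelled by the subword of length `l` of `c` that starts at position `p`. -/
def subwordValue (a : FreeGroupBasis (Fin n) A) (c : ℕ → Fin n × Bool) (p l : ℕ) : A :=
  ((List.range l).map fun j => letterValue a (c (p + j))).prod

/-- The endpoint `e` of the Cayley tree is represented by the infinite word `c`: it is the end of
the geodesic ray from `1` through the vertices spelled by the initial subwords of `c`. -/
def IsRepresentedBy (a : FreeGroupBasis (Fin n) A) (e : GeodesicBoundary (CayleyTree a))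
    (c : ℕ → Fin n × Bool) : Prop :=
  IsReducedInfiniteWord c ∧ ∃ τ : GeodesicRay (CayleyTree a), τ.endpoint = e ∧
    ∀ m : ℕ, τ (m : ℝ≥0) = Realization.vertex _ (subwordValue a c 0 m)

/-- The infinite word `c` contains infinitely many commutators: infinitely many of its nonempty
subwords (told apart by their positions) spell a commutator of two elements of `A`. -/
def ContainsInfinitelyManyCommutators (a : FreeGroupBasis (Fin n) A) (c : ℕ → Fin n × Bool) :
    Prop :=
  {s : ℕ × ℕ | 0 < s.2 ∧ subwordValue a c s.1 s.2 ∈ commutatorSet A}.Infinite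

end CayleyTree

end

/-! A constant lag suffices as soon as the group elements that move a base point into a horoball are
joined, inside that horoball, by steps from one finite set (`mem_sigmaOne_of_horoStep`). The
1-skeleton is connected and cocompact, so passing between its paths and such chains changes horoball
levels by a bounded amount only.

For `G = B ⋊ A` the steps are the letters of `A`, which move `(b, x)` along the tree, and finitely
many `f` in `B`, which send `(b, x)` to `(b * φ x f, x)`. Horoballs of the tree are connected, so
`x` can be moved freely within one while `b` stays fixed. A single `x` only changes `b` by the
elements `φ x f`, whereas generating `B` takes `φ u f` for all `u` in `A`, with `f` running over the
`B`-coordinates of a finite generating set of `G` (`eqvGen_horoStep`). It is therefore enough that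
every value of `φ` is attained in every horoball at the end, however deep
(`exists_mem_horoball_map_eq`).

This is where commutators enter. As `φ(A)` is abelian, deleting commutator subwords from an initial
subword `w` of length `m` keeps the value of `φ`, and it yields an element `y` whose length is below
`m` by any prescribed amount (`exists_shortened`). Then `w * y⁻¹ * u` has the same image as `u` and
lies within `|u| + |y|` of the ray point `w`, hence deep in the horoball.

For nonemptiness, the infinite power of the commutator of two basis elements is a reduced word, and
the path along it is a geodesic ray (`wordRay`). -/

/-! ## Unions of cells -/

section CellUnion

set_option linter.unusedSectionVars false

open RelCWComplex

variable {X : Type w} [TopologicalSpace X] [T2Space X] [CWComplex (univ : Set X)]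

/-- A set of points is a cell union if it contains, with every point, the closure of the open
cell of that point. These are the underlying sets of subcomplexes. -/
def IsCellUnion (S : Set X) : Prop :=
  ∀ x ∈ S, ∃ (n : ℕ) (i : cell (univ : Set X) n), x ∈ openCell n i ∧ closedCell n i ⊆ S

theorem exists_mem_openCell (x : X) :
    ∃ (n : ℕ) (i : cell (univ : Set X) n), x ∈ openCell n i := by
  have h : x ∈ ⋃ (n : ℕ) (j : cell (univ : Set X) n), openCell n j := by
    rw [CWComplex.iUnion_openCell_eq_complex]
    trivial
  simpa using h

theorem cell_eq_of_mem {x : X} {n m : ℕ} {i : cell (univ : Set X) n} {j : cell (univ : Set X) m}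
    (hi : x ∈ openCell n i) (hj : x ∈ openCell m j) :
    (⟨n, i⟩ : Σ n, cell (univ : Set X) n) = ⟨m, j⟩ :=
  eq_of_not_disjoint_openCell (Set.not_disjoint_iff.2 ⟨x, hi, hj⟩)

theorem IsCellUnion.closedCell_subset {S : Set X} (hS : IsCellUnion S) {x : X} (hx : x ∈ S)
    {n : ℕ} {i : cell (univ : Set X) n} (hi : x ∈ openCell n i) : closedCell n i ⊆ S := by
  obtain ⟨m, j, hj, hjS⟩ := hS x hx
  cases cell_eq_of_mem hi hj
  exact hjS

theorem IsCellUnion.exists_subcomplex {S : Set X} (hS : IsCellUnion S) :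
    ∃ E : Subcomplex (univ : Set X), (E : Set X) = S := by
  refine ⟨CWComplex.Subcomplex.mk' _ S (fun n => {i | closedCell n i ⊆ S}) (fun n i => i.2) ?_,
    rfl⟩
  apply subset_antisymm
  · simp only [iUnion_subset_iff]
    exact fun n i => (openCell_subset_closedCell _ _).trans i.2
  · intro x hx
    obtain ⟨n, i, hi, hiS⟩ := hS x hx
    simp only [mem_iUnion]
    exact ⟨n, ⟨i, hiS⟩, hi⟩

/-- By the weak topology no finiteness is needed, so arbitrary families of cells can enter the
connectedness arguments below. -/
theorem IsCellUnion.isClosed {S : Set X} (hS : IsCellUnion S) : IsClosed S := by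
  obtain ⟨E, rfl⟩ := hS.exists_subcomplex
  exact E.closed

theorem isCellUnion_univ : IsCellUnion (univ : Set X) := by
  intro x _
  obtain ⟨n, i, hi⟩ := exists_mem_openCell x
  exact ⟨n, i, hi, subset_univ _⟩

theorem IsCellUnion.union {S S' : Set X} (hS : IsCellUnion S) (hS' : IsCellUnion S') :
    IsCellUnion (S ∪ S') := by
  rintro x (hx | hx)
  · obtain ⟨n, i, hi, hiS⟩ := hS x hx
    exact ⟨n, i, hi, hiS.trans subset_union_left⟩
  · obtain ⟨n, i, hi, hiS⟩ := hS' x hx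
    exact ⟨n, i, hi, hiS.trans subset_union_right⟩

theorem IsCellUnion.inter {S S' : Set X} (hS : IsCellUnion S) (hS' : IsCellUnion S') :
    IsCellUnion (S ∩ S') := by
  intro x hx
  obtain ⟨n, i, hi, hiS⟩ := hS x hx.1
  exact ⟨n, i, hi, subset_inter hiS (hS'.closedCell_subset hx.2 hi)⟩

theorem isCellUnion_sUnion {F : Set (Set X)} (hF : ∀ S ∈ F, IsCellUnion S) :
    IsCellUnion (⋃₀ F) := by
  rintro x ⟨S, hS, hx⟩
  obtain ⟨n, i, hi, hiS⟩ := hF S hS x hx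
  exact ⟨n, i, hi, hiS.trans (subset_sUnion_of_mem hS)⟩

theorem IsCellUnion.union_closedCell {S : Set X} (hS : IsCellUnion S) {n : ℕ}
    {i : cell (univ : Set X) n} (hi : cellFrontier n i ⊆ S) : IsCellUnion (S ∪ closedCell n i) := by
  rw [← cellFrontier_union_openCell_eq_closedCell, ← union_assoc, union_eq_left.2 hi]
  rintro x (hx | hx)
  · obtain ⟨m, j, hj, hjS⟩ := hS x hx
    exact ⟨m, j, hj, hjS.trans subset_union_left⟩
  · refine ⟨n, i, hx, ?_⟩
    rw [← cellFrontier_union_openCell_eq_closedCell]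
    exact union_subset_union_left _ hi

theorem mem_zeroCell_of_mem_closedCell {x : X} {j : cell (univ : Set X) 0}
    (hx : x ∈ closedCell 0 j) : x ∈ openCell 0 j ∧ closedCell 0 j = {x} := by
  rw [closedCell_zero_eq_singleton] at hx ⊢
  rw [openCell_zero_eq_singleton]
  exact ⟨hx, by rw [hx]⟩

theorem isCellUnion_closedCell_zero (j : cell (univ : Set X) 0) : IsCellUnion (closedCell 0 j) :=
  fun _ hx => ⟨0, j, (mem_zeroCell_of_mem_closedCell hx).1, subset_rfl⟩

/-- The frontier of an edge consists of vertices. In higher dimensions a closed cell need not be a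
subcomplex, since its frontier may meet other cells only partially. -/
theorem isCellUnion_closedCell_one (i : cell (univ : Set X) 1) : IsCellUnion (closedCell 1 i) := by
  obtain ⟨x, y, hxy⟩ := CWComplex.exists_cellFrontier_one_eq i
  have h := ((isCellUnion_closedCell_zero x).union (isCellUnion_closedCell_zero y)).union_closedCell
    (i := i) hxy.subset
  rwa [← hxy, union_eq_right.2 (cellFrontier_subset_closedCell _ _)] at h

theorem isCellUnion_closedCell {n : ℕ} (hn : n ≤ 1) (i : cell (univ : Set X) n) :
    IsCellUnion (closedCell n i) := by
  interval_cases n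
  · exact isCellUnion_closedCell_zero i
  · exact isCellUnion_closedCell_one i

theorem isPathConnected_closedCell {n : ℕ} (i : cell (univ : Set X) n) :
    IsPathConnected (closedCell n i) :=
  ((convex_closedBall (0 : Fin n → ℝ) 1).isPathConnected
    ⟨0, by simp⟩).image' (continuousOn n i)

theorem isPreconnected_cellFrontier {n : ℕ} (hn : 2 ≤ n) (i : cell (univ : Set X) n) :
    IsPreconnected (cellFrontier n i) := by
  refine (isPreconnected_sphere ?_ _ _).image _
    ((continuousOn n i).mono Metric.sphere_subset_closedBall)
  rw [rank_fin_fun]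
  exact_mod_cast hn

/-- A nonempty cell union contains a vertex. -/
theorem IsCellUnion.exists_vertex {S : Set X} (hS : IsCellUnion S) (hne : S.Nonempty) :
    ∃ j : cell (univ : Set X) 0, closedCell 0 j ⊆ S := by
  have key : ∀ n : ℕ, ∀ i : cell (univ : Set X) n, closedCell n i ⊆ S →
      ∃ j : cell (univ : Set X) 0, closedCell 0 j ⊆ S := by
    intro n
    induction n using Nat.strong_induction_on with
    | _ n ih =>
      intro i hi
      rcases eq_or_ne n 0 with rfl | hn
      · exact ⟨i, hi⟩
      -- A frontier point lies in an open cell of smaller dimension, whose closed cell `S` must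
      -- contain as well.
      obtain ⟨y, hy⟩ := nonempty_cellFrontier hn i
      obtain ⟨I, hI⟩ := CWComplex.cellFrontier_subset_finite_openCell n i
      have hy' := hI hy
      simp only [mem_iUnion] at hy'
      obtain ⟨m, hm, j, -, hj⟩ := hy'
      exact ih m hm j (hS.closedCell_subset (hi (cellFrontier_subset_closedCell _ _ hy)) hj)
  obtain ⟨x, hx⟩ := hne
  obtain ⟨n, i, -, hi⟩ := hS x hx
  exact key n i hi

/-- The largest cell union all of whose vertices lie in `C`. -/
def cellUnionWithVertices (C : Set X) : Set X :=
  ⋃₀ {S | IsCellUnion S ∧ ∀ j : cell (univ : Set X) 0, closedCell 0 j ⊆ S → closedCell 0 j ⊆ C}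

theorem isCellUnion_cellUnionWithVertices (C : Set X) : IsCellUnion (cellUnionWithVertices C) :=
  isCellUnion_sUnion fun _ hS => hS.1

theorem vertex_subset_cellUnionWithVertices {C : Set X} {j : cell (univ : Set X) 0} :
    closedCell 0 j ⊆ cellUnionWithVertices C ↔ closedCell 0 j ⊆ C := by
  constructor
  · intro h
    obtain ⟨S, ⟨hS, hSC⟩, hx⟩ := h (map_zero_mem_closedCell 0 j)
    exact hSC j (hS.closedCell_subset hx (map_zero_mem_openCell 0 j))
  · refine fun h => subset_sUnion_of_mem ⟨isCellUnion_closedCell_zero j, fun k hk => ?_⟩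
    exact hk.trans h

theorem disjoint_cellUnionWithVertices (C : Set X) :
    Disjoint (cellUnionWithVertices C) (cellUnionWithVertices Cᶜ) := by
  rw [Set.disjoint_iff_inter_eq_empty, ← Set.not_nonempty_iff_eq_empty]
  intro hne
  obtain ⟨j, hj⟩ := ((isCellUnion_cellUnionWithVertices C).inter
    (isCellUnion_cellUnionWithVertices Cᶜ)).exists_vertex hne
  have h1 := vertex_subset_cellUnionWithVertices.1 (hj.trans inter_subset_left)
  have h2 := vertex_subset_cellUnionWithVertices.1 (hj.trans inter_subset_right)
  exact h2 (map_zero_mem_closedCell 0 j) (h1 (map_zero_mem_closedCell 0 j))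

theorem closedCell_one_subset_cellUnionWithVertices {C : Set X} {i : cell (univ : Set X) 1}
    (h : closedCell 1 i ⊆ C) : closedCell 1 i ⊆ cellUnionWithVertices C :=
  subset_sUnion_of_mem ⟨isCellUnion_closedCell_one i, fun _ hj => hj.trans h⟩

/-- Attaching a cell of positive dimension adds no vertex, so maximality of the cell union absorbs
it. -/
theorem closedCell_subset_of_cellFrontier_subset {C : Set X} {n : ℕ} (hn : n ≠ 0)
    {i : cell (univ : Set X) n} (h : cellFrontier n i ⊆ cellUnionWithVertices C) :
    closedCell n i ⊆ cellUnionWithVertices C := by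
  refine subset_union_right.trans (subset_sUnion_of_mem
    ⟨(isCellUnion_cellUnionWithVertices C).union_closedCell h, fun j hj => ?_⟩)
  rw [← cellFrontier_union_openCell_eq_closedCell n i, ← union_assoc, union_eq_left.2 h] at hj
  refine vertex_subset_cellUnionWithVertices.1 ?_
  rcases hj (map_zero_mem_closedCell 0 j) with hx | hx
  · exact (isCellUnion_cellUnionWithVertices C).closedCell_subset hx (map_zero_mem_openCell 0 j)
  · have := cell_eq_of_mem hx (map_zero_mem_openCell 0 j)
    simp only [Sigma.mk.injEq] at this
    exact absurd this.1 hn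

/-- Cells of dimension at least 2 cannot connect what the edges leave apart: the frontier of such a
cell is connected and, by induction on the dimension, covered by two disjoint closed sets, so it
lies in one of them. -/
theorem closedCell_subset_or {C : Set X}
    (hC : ∀ i : cell (univ : Set X) 1, closedCell 1 i ⊆ C ∨ closedCell 1 i ⊆ Cᶜ)
    (n : ℕ) (i : cell (univ : Set X) n) :
    closedCell n i ⊆ cellUnionWithVertices C ∨ closedCell n i ⊆ cellUnionWithVertices Cᶜ := by
  induction n using Nat.strong_induction_on with
  | _ n ih =>
    rcases Nat.lt_or_ge n 2 with hn | hn
    · interval_cases n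
      · rw [vertex_subset_cellUnionWithVertices, vertex_subset_cellUnionWithVertices,
          closedCell_zero_eq_singleton, singleton_subset_iff, singleton_subset_iff]
        exact em _
      · exact (hC i).imp closedCell_one_subset_cellUnionWithVertices
          closedCell_one_subset_cellUnionWithVertices
    · have hcover : cellFrontier n i ⊆ cellUnionWithVertices C ∪ cellUnionWithVertices Cᶜ := by
        obtain ⟨I, hI⟩ := CWComplex.cellFrontier_subset_finite_closedCell n i
        refine hI.trans ?_
        simp only [iUnion_subset_iff]
        intro m hm j _
        exact (ih m hm j).elim (fun h => h.trans subset_union_left)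
          (fun h => h.trans subset_union_right)
      have := isPreconnected_iff_subset_of_disjoint_closed.1 (isPreconnected_cellFrontier hn i) _ _
        (isCellUnion_cellUnionWithVertices C).isClosed
        (isCellUnion_cellUnionWithVertices Cᶜ).isClosed hcover
        (by rw [(disjoint_cellUnionWithVertices C).inter_eq, inter_empty])
      exact this.imp (closedCell_subset_of_cellFrontier_subset (by omega))
        (closedCell_subset_of_cellFrontier_subset (by omega))

/-- In a connected complex, a set that no edge leaves contains every vertex or none. -/
theorem vertex_subset_of_isPreconnected [PreconnectedSpace X] {C : Set X}
    (hC : ∀ i : cell (univ : Set X) 1, closedCell 1 i ⊆ C ∨ closedCell 1 i ⊆ Cᶜ)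
    {j₀ : cell (univ : Set X) 0} (hj₀ : closedCell 0 j₀ ⊆ C) (j : cell (univ : Set X) 0) :
    closedCell 0 j ⊆ C := by
  have hcover : (univ : Set X) ⊆ cellUnionWithVertices C ∪ cellUnionWithVertices Cᶜ := by
    intro x _
    obtain ⟨n, i, hi⟩ := exists_mem_openCell x
    have hi' := openCell_subset_closedCell n i hi
    exact (closedCell_subset_or hC n i).imp (fun h => h hi') (fun h => h hi')
  have := isPreconnected_iff_subset_of_disjoint_closed.1 (isPreconnected_univ (α := X)) _ _
    (isCellUnion_cellUnionWithVertices C).isClosed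
    (isCellUnion_cellUnionWithVertices Cᶜ).isClosed hcover
    (by rw [(disjoint_cellUnionWithVertices C).inter_eq, inter_empty])
  rcases this with h | h
  · exact vertex_subset_cellUnionWithVertices.1 ((subset_univ _).trans h)
  · have := vertex_subset_cellUnionWithVertices.1 ((subset_univ (closedCell 0 j₀)).trans h)
    exact absurd (hj₀ (map_zero_mem_closedCell 0 j₀)) (this (map_zero_mem_closedCell 0 j₀))

theorem closedCell_subset_oneSkeleton {n : ℕ} (hn : n ≤ 1) (i : cell (univ : Set X) n) :
    closedCell n i ⊆ oneSkeleton X :=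
  (closedCell_subset_skeleton n i).trans (skeleton_mono (by exact_mod_cast hn))

theorem mem_oneSkeleton_iff {x : X} :
    x ∈ oneSkeleton X ↔ ∃ n ≤ 1, ∃ i : cell (univ : Set X) n, x ∈ openCell n i := by
  have := CWComplex.mem_skeleton_iff (C := (univ : Set X)) (n := 1) (x := x)
  rw [oneSkeleton, SetLike.mem_coe, this]
  simp

/-- `x` and `y` are joined inside a cell union in the `1`-skeleton whose image under `h` is
bounded. -/
def BoundedJoined {M : Type v} [MetricSpace M] (h : X → M) (x y : X) : Prop :=
  ∃ S : Set X, IsCellUnion S ∧ S ⊆ oneSkeleton X ∧ Bornology.IsBounded (h '' S) ∧ JoinedIn S x y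

variable {M : Type v} [MetricSpace M] {h : X → M}

theorem BoundedJoined.symm {x y : X} (hxy : BoundedJoined h x y) : BoundedJoined h y x := by
  obtain ⟨S, h1, h2, h3, h4⟩ := hxy
  exact ⟨S, h1, h2, h3, h4.symm⟩

theorem BoundedJoined.trans {x y z : X} (hxy : BoundedJoined h x y) (hyz : BoundedJoined h y z) :
    BoundedJoined h x z := by
  obtain ⟨S, h1, h2, h3, h4⟩ := hxy
  obtain ⟨S', k1, k2, k3, k4⟩ := hyz
  refine ⟨S ∪ S', h1.union k1, union_subset h2 k2, ?_,
    (h4.mono subset_union_left).trans (k4.mono subset_union_right)⟩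
  rw [image_union]
  exact h3.union k3

theorem isBounded_image_closedCell (hh : ContinuousOn h (oneSkeleton X)) {n : ℕ} (hn : n ≤ 1)
    (i : cell (univ : Set X) n) : Bornology.IsBounded (h '' closedCell n i) :=
  ((isCompact_closedCell (C := (univ : Set X))).image_of_continuousOn
    (hh.mono (closedCell_subset_oneSkeleton hn i))).isBounded

theorem boundedJoined_of_mem_closedCell (hh : ContinuousOn h (oneSkeleton X)) {n : ℕ} (hn : n ≤ 1)
    {i : cell (univ : Set X) n} {x y : X} (hx : x ∈ closedCell n i) (hy : y ∈ closedCell n i) :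
    BoundedJoined h x y :=
  ⟨closedCell n i, isCellUnion_closedCell hn i, closedCell_subset_oneSkeleton hn i,
    isBounded_image_closedCell hh hn i, (isPathConnected_closedCell i).joinedIn x hx y hy⟩

/-- The set of points that are boundedly joined to `x` absorbs every edge it meets, because an edge
is compact and path connected; connectedness of the complex then gives it all vertices. -/
theorem boundedJoined [PreconnectedSpace X] (hh : ContinuousOn h (oneSkeleton X)) {x y : X}
    (hx : x ∈ oneSkeleton X) (hy : y ∈ oneSkeleton X) : BoundedJoined h x y := by
  have toVertex : ∀ x ∈ oneSkeleton X, ∃ j : cell (univ : Set X) 0,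
      ∀ z ∈ closedCell 0 j, BoundedJoined h x z := by
    intro x hx
    obtain ⟨n, hn, i, hi⟩ := mem_oneSkeleton_iff.1 hx
    obtain ⟨j, hj⟩ := (isCellUnion_closedCell hn i).exists_vertex (closedCell_nonempty n i)
    exact ⟨j, fun z hz => boundedJoined_of_mem_closedCell hh hn
      (openCell_subset_closedCell _ _ hi) (hj hz)⟩
  obtain ⟨j, hj⟩ := toVertex x hx
  obtain ⟨k, hk⟩ := toVertex y hy
  have key := vertex_subset_of_isPreconnected (C := {z | BoundedJoined h x z}) ?_ hj k
  · exact (key (map_zero_mem_closedCell 0 k)).trans (hk _ (map_zero_mem_closedCell 0 k)).symm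
  · intro i
    by_cases hi : ∃ z ∈ closedCell 1 i, BoundedJoined h x z
    · obtain ⟨z, hz, hxz⟩ := hi
      exact Or.inl fun z' hz' => hxz.trans (boundedJoined_of_mem_closedCell hh le_rfl hz hz')
    · exact Or.inr fun z hz hxz => hi ⟨z, hz, hxz⟩

theorem subset_horoPreimage {S : Set X} (hS : IsCellUnion S) (hS1 : S ⊆ oneSkeleton X)
    {τ : GeodesicRay M} {t : ℝ} (ht : S ⊆ h ⁻¹' τ.horoball t) : S ⊆ horoPreimage h τ t := by
  obtain ⟨E, rfl⟩ := hS.exists_subcomplex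
  exact fun x hx => ⟨E, hS1, ht, hx⟩

end CellUnion

/-! ## The coarse geometry of the `1`-skeleton -/

section Translates

open RelCWComplex

variable {X : Type w} [TopologicalSpace X] [T2Space X] [CWComplex (univ : Set X)]
  {G : Type u} [Group G] [MulAction G X] {M : Type v} [MetricSpace M] {h : X → M}
  {ρ : G →* (M ≃ᵢ M)}

/-- The homeomorphism by which a group element acts on a `G`-complex. -/
def IsContractibleFreeGCW.homeomorph (hX : IsContractibleFreeGCW G X) (g : G) : X ≃ₜ X where
  toEquiv := MulAction.toPerm g
  continuous_toFun := hX.continuous_smul g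
  continuous_invFun := hX.continuous_smul g⁻¹

theorem IsContractibleFreeGCW.image_closedCell (hX : IsContractibleFreeGCW G X) {g : G} {n : ℕ}
    {i j : cell (univ : Set X) n} (hij : (fun x => g • x) '' openCell n i = openCell n j) :
    (fun x => g • x) '' closedCell n i = closedCell n j := by
  rw [← closure_openCell_eq_closedCell, ← closure_openCell_eq_closedCell, ← hij]
  exact (hX.homeomorph g).image_closure _

theorem IsCellUnion.image_smul (hX : IsContractibleFreeGCW G X) {S : Set X} (hS : IsCellUnion S)
    (g : G) : IsCellUnion ((fun x => g • x) '' S) := by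
  rintro _ ⟨x, hx, rfl⟩
  obtain ⟨n, i, hi, hiS⟩ := hS x hx
  obtain ⟨j, hj⟩ := hX.map_cell g n i
  refine ⟨n, j, hj ▸ mem_image_of_mem _ hi, ?_⟩
  rw [← hX.image_closedCell hj]
  exact image_mono hiS

theorem IsContractibleFreeGCW.smul_mem_oneSkeleton (hX : IsContractibleFreeGCW G X) (g : G) {x : X}
    (hx : x ∈ oneSkeleton X) : g • x ∈ oneSkeleton X := by
  obtain ⟨n, hn, i, hi⟩ := mem_oneSkeleton_iff.1 hx
  obtain ⟨j, hj⟩ := hX.map_cell g n i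
  exact mem_oneSkeleton_iff.2 ⟨n, hn, j, hj ▸ mem_image_of_mem _ hi⟩

/-- `x` and `y` are joined inside a cell union in the `1`-skeleton whose image under `h` lies
within `D` of `h x`. -/
def JoinedWithin (h : X → M) (D : ℝ) (x y : X) : Prop :=
  ∃ S : Set X, IsCellUnion S ∧ S ⊆ oneSkeleton X ∧ JoinedIn S x y ∧
    ∀ z ∈ S, dist (h z) (h x) ≤ D

theorem JoinedWithin.mono {D D' : ℝ} (hD : D ≤ D') {x y : X} (hxy : JoinedWithin h D x y) :
    JoinedWithin h D' x y := by
  obtain ⟨S, h1, h2, h3, h4⟩ := hxy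
  exact ⟨S, h1, h2, h3, fun z hz => (h4 z hz).trans hD⟩

theorem JoinedWithin.smul (hX : IsContractibleFreeGCW G X) (hh : IsControlMap ρ h) {D : ℝ} {x y : X}
    (hxy : JoinedWithin h D x y) (g : G) : JoinedWithin h D (g • x) (g • y) := by
  obtain ⟨S, h1, h2, h3, h4⟩ := hxy
  refine ⟨_, h1.image_smul hX g, ?_, h3.map_continuousOn (f := fun x => g • x)
    (hX.continuous_smul g).continuousOn, ?_⟩
  · rintro _ ⟨z, hz, rfl⟩
    exact hX.smul_mem_oneSkeleton g (h2 hz)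
  · rintro _ ⟨z, hz, rfl⟩
    change dist (h (g • z)) _ ≤ D
    rw [hh.equivariant g z (h2 hz), hh.equivariant g x (h2 h3.source_mem), (ρ g).dist_eq]
    exact h4 z hz

/-- Enlarging the balls that make up a horoball by `D` lowers its level by `D`. -/
theorem JoinedWithin.joinedIn {D : ℝ} {x y : X} (hxy : JoinedWithin h D x y) {τ : GeodesicRay M}
    {t : ℝ} (hx : h x ∈ τ.horoball t) : JoinedIn (horoPreimage h τ (t - D)) x y := by
  obtain ⟨S, h1, h2, h3, h4⟩ := hxy
  refine h3.mono (subset_horoPreimage h1 h2 fun z hz => ?_)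
  obtain ⟨l, hl, hd⟩ := hx
  have hz' := h4 z hz
  have hD : 0 ≤ D := dist_nonneg.trans hz'
  refine ⟨l, by linarith, ?_⟩
  have := dist_triangle (h z) (h x) (τ l)
  linarith

theorem BoundedJoined.joinedWithin {x y : X} (hxy : BoundedJoined h x y) :
    ∃ D, JoinedWithin h D x y := by
  obtain ⟨S, h1, h2, h3, h4⟩ := hxy
  obtain ⟨D, hD⟩ := Metric.isBounded_iff.1 h3
  exact ⟨D, S, h1, h2, h4, fun z hz =>
    hD (mem_image_of_mem h hz) (mem_image_of_mem h h4.source_mem)⟩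

theorem exists_joinedWithin_closedCell [PreconnectedSpace X] (hh : ContinuousOn h (oneSkeleton X))
    {v₀ : X} (hv₀ : v₀ ∈ oneSkeleton X) {n : ℕ} (hn : n ≤ 1) (i : cell (univ : Set X) n) :
    ∃ D, ∀ x ∈ closedCell n i, JoinedWithin h D x v₀ := by
  obtain ⟨S, h1, h2, h3, h4⟩ := boundedJoined hh
    (closedCell_subset_oneSkeleton hn i (map_zero_mem_closedCell n i)) hv₀
  have hb : Bornology.IsBounded (h '' (S ∪ closedCell n i)) := by
    rw [image_union]
    exact h3.union (isBounded_image_closedCell hh hn i)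
  obtain ⟨D, hD⟩ := Metric.isBounded_iff.1 hb
  refine ⟨D, fun x hx => ⟨_, h1.union (isCellUnion_closedCell hn i),
    union_subset h2 (closedCell_subset_oneSkeleton hn i), ?_, fun z hz =>
    hD (mem_image_of_mem h hz) (mem_image_of_mem h (Or.inr hx))⟩⟩
  exact (((isPathConnected_closedCell i).joinedIn x hx _ (map_zero_mem_closedCell n i)).mono
    subset_union_right).trans (h4.mono subset_union_left)

/-- One bound serves for each of the finitely many representative cells, and translation preserves
it because `ρ` acts by isometries. -/
theorem exists_joinedWithin_orbit [PreconnectedSpace X] (hX : IsContractibleFreeGCW G X)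
    (hcc : HasCocompactOneSkeleton G X) (hh : IsControlMap ρ h) {v₀ : X}
    (hv₀ : v₀ ∈ oneSkeleton X) :
    ∃ D, ∀ x ∈ oneSkeleton X, ∃ g : G, JoinedWithin h D x (g • v₀) := by
  have key : ∀ n ≤ 1, ∃ D, ∀ i : cell (univ : Set X) n, ∀ x ∈ openCell n i,
      ∃ g : G, JoinedWithin h D x (g • v₀) := by
    intro n hn
    obtain ⟨F, hF, hFi⟩ := hcc n hn
    choose D hD using fun j : cell (univ : Set X) n =>
      exists_joinedWithin_closedCell hh.continuousOn hv₀ hn j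
    obtain ⟨C, hC⟩ := (hF.image D).bddAbove
    refine ⟨C, fun i x hx => ?_⟩
    obtain ⟨j, hj, g, hg⟩ := hFi i
    rw [← hg] at hx
    obtain ⟨y, hy, rfl⟩ := hx
    exact ⟨g, ((hD j y (openCell_subset_closedCell _ _ hy)).mono
      (hC (mem_image_of_mem D hj))).smul hX hh g⟩
  obtain ⟨D₀, h0⟩ := key 0 zero_le_one
  obtain ⟨D₁, h1⟩ := key 1 le_rfl
  refine ⟨max D₀ D₁, fun x hx => ?_⟩
  obtain ⟨n, hn, i, hi⟩ := mem_oneSkeleton_iff.1 hx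
  interval_cases n
  · obtain ⟨g, hg⟩ := h0 i x hi
    exact ⟨g, hg.mono (le_max_left _ _)⟩
  · obtain ⟨g, hg⟩ := h1 i x hi
    exact ⟨g, hg.mono (le_max_right _ _)⟩

theorem exists_joinedWithin_mul [PreconnectedSpace X] (hX : IsContractibleFreeGCW G X)
    (hh : IsControlMap ρ h) {v₀ : X} (hv₀ : v₀ ∈ oneSkeleton X) {K : Set G} (hK : K.Finite) :
    ∃ D, ∀ k ∈ K, ∀ g : G, JoinedWithin h D (g • v₀) ((g * k) • v₀) := by
  choose D hD using fun k : G =>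
    (boundedJoined hh.continuousOn hv₀ (hX.smul_mem_oneSkeleton k hv₀)).joinedWithin
  obtain ⟨C, hC⟩ := (hK.image D).bddAbove
  refine ⟨C, fun k hk g => ?_⟩
  rw [mul_smul]
  exact ((hD k).mono (hC (mem_image_of_mem D hk))).smul hX hh g

/-- Replacing the ray by an asymptotic one costs `C`, and moving the point costs `D`. This makes the
choice of ray and of base point harmless. -/
theorem horoball_mono_of_dist_le {τ σ : GeodesicRay M} {C : ℝ} (hC : ∀ l, dist (τ l) (σ l) ≤ C)
    {x y : M} {D t : ℝ} (hxy : dist y x ≤ D) (hx : x ∈ τ.horoball t) :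
    y ∈ σ.horoball (t - C - D) := by
  obtain ⟨l, hl, hd⟩ := hx
  have hC0 : 0 ≤ C := dist_nonneg.trans (hC l)
  have hD0 : 0 ≤ D := dist_nonneg.trans hxy
  refine ⟨l, by linarith, ?_⟩
  have h1 := dist_triangle4 y x (τ l) (σ l)
  have h2 := hC l
  linarith

theorem GeodesicRay.horoball_anti {τ : GeodesicRay M} {s t : ℝ} (hst : s ≤ t) :
    τ.horoball t ⊆ τ.horoball s := by
  rintro x ⟨l, hl, hd⟩
  exact ⟨l, by linarith, by linarith⟩

theorem horoPreimage_anti {τ : GeodesicRay M} {s t : ℝ} (hst : s ≤ t) :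
    horoPreimage h τ t ⊆ horoPreimage h τ s := by
  rintro x ⟨E, h1, h2, h3⟩
  exact ⟨E, h1, h2.trans (preimage_mono (GeodesicRay.horoball_anti hst)), h3⟩

/-- Group elements `g` and `g'` that move the point `o` into the horoball `HB_t(σ)` and differ by
an element of `K`. -/
def HoroStep (ρ : G →* (M ≃ᵢ M)) (σ : GeodesicRay M) (o : M) (K : Set G) (t : ℝ) (g g' : G) :
    Prop :=
  ρ g o ∈ σ.horoball t ∧ ρ g' o ∈ σ.horoball t ∧ g⁻¹ * g' ∈ K

/-- If group elements that move `o` into a horoball are always joined by a chain of group elements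
with this property and bounded steps, then the end of the horoballs lies in `Σ¹`. -/
theorem mem_sigmaOne_of_horoStep {σ : GeodesicRay M} {o : M} {K : Set G} (hK : K.Finite)
    (hσ : ∀ t g g', ρ g o ∈ σ.horoball t → ρ g' o ∈ σ.horoball t →
      Relation.EqvGen (HoroStep ρ σ o K t) g g') :
    σ.endpoint ∈ SigmaOne.{w} ρ := by
  intro X _ _ _ _ h τ hX hcc hh hτ
  obtain ⟨C, hC⟩ : ∃ C : ℝ, ∀ t, dist (τ t) (σ t) ≤ C := Quotient.exact hτ
  have := hX.contractible
  obtain ⟨j₀, -⟩ := (isCellUnion_univ (X := X)).exists_vertex univ_nonempty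
  obtain ⟨v₀, hv₀⟩ : ∃ v₀, v₀ ∈ oneSkeleton X :=
    ⟨_, closedCell_subset_oneSkeleton zero_le_one j₀ (map_zero_mem_closedCell 0 j₀)⟩
  obtain ⟨D₁, hD₁⟩ := exists_joinedWithin_orbit hX hcc hh hv₀
  obtain ⟨D₂, hD₂⟩ := exists_joinedWithin_mul hX hh hv₀ hK
  have hC0 : 0 ≤ C := dist_nonneg.trans (hC 0)
  set R := dist (h v₀) o with hR
  have hR0 : 0 ≤ R := dist_nonneg
  have hρ : ∀ g : G, dist (h (g • v₀)) (ρ g o) = R := fun g => by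
    rw [hh.equivariant g v₀ hv₀, (ρ g).dist_eq]
  -- The alternative `g = g'` covers the empty chain, which carries no information that `g • v₀`
  -- lies over the horoball.
  have chain : ∀ t g g', Relation.EqvGen (HoroStep ρ σ o K t) g g' →
      g = g' ∨ JoinedIn (horoPreimage h τ (t - C - R - |D₂|)) (g • v₀) (g' • v₀) := by
    intro t g g' hgg'
    induction hgg' with
    | rel g g' hs =>
      obtain ⟨h1, -, h3⟩ := hs
      have h4 := ((hD₂ _ h3 g).mono (le_abs_self _)).joinedIn (τ := τ)
        (horoball_mono_of_dist_le (fun l => by rw [dist_comm]; exact hC l) (hρ g).le h1)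
      rw [mul_inv_cancel_left] at h4
      exact Or.inr h4
    | refl g => exact Or.inl rfl
    | symm g g' _ ih => exact ih.imp Eq.symm JoinedIn.symm
    | trans g g' g'' _ _ ih ih' =>
      rcases ih with rfl | ih
      · exact ih'
      rcases ih' with rfl | ih'
      · exact Or.inr ih
      · exact Or.inr (ih.trans ih')
  -- Going from a point to the orbit of `v₀`, and from `τ` and `h v₀` to `σ` and `o`, costs `|D₁| +
  -- C + R`; returning costs `C + R`, and the paths that realize the steps cost `|D₂|`.
  set Λ := |D₁| + C + R + C + R + |D₂| with hΛ
  have hΛ0 : 0 ≤ Λ := by positivity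
  refine ⟨fun _ => ⟨Λ, hΛ0⟩, fun t x hx y hy => ?_, ?_⟩
  · change JoinedIn (horoPreimage h τ (t - Λ)) x y
    have toOrbit : ∀ x ∈ horoPreimage h τ t, ∃ g : G,
        JoinedIn (horoPreimage h τ (t - Λ)) x (g • v₀) ∧
          ρ g o ∈ σ.horoball (t - |D₁| - C - R) := by
      rintro x ⟨E, hE1, hE2, hxE⟩
      obtain ⟨g, hg⟩ := hD₁ x (hE1 hxE)
      have hj := (hg.mono (le_abs_self _)).joinedIn (hE2 hxE)
      refine ⟨g, hj.mono (horoPreimage_anti ?_), ?_⟩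
      · have := abs_nonneg D₂
        linarith
      · obtain ⟨E', -, hE2', hxE'⟩ := hj.target_mem
        exact horoball_mono_of_dist_le hC (by rw [dist_comm]; exact (hρ g).le) (hE2' hxE')
    obtain ⟨g, hg, hgσ⟩ := toOrbit x hx
    obtain ⟨g', hg', hgσ'⟩ := toOrbit y hy
    rcases chain _ g g' (hσ _ g g' hgσ hgσ') with rfl | hj
    · exact hg.trans hg'.symm
    · refine (hg.trans (hj.mono (horoPreimage_anti ?_))).trans hg'.symm
      linarith
  · exact Filter.tendsto_atTop_add_const_right _ (-Λ) Filter.tendsto_id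

end Translates

/-! ## Word length and distances in the Cayley tree -/

section WordLength

open SimpleGraph

variable {A : Type u} [Group A] {n : ℕ} (a : FreeGroupBasis (Fin n) A)

/-- The length of the reduced word that spells an element of a free group. -/
def wordLength (x : A) : ℕ := (a.repr x).norm

theorem wordLength_mul_le (x y : A) : wordLength a (x * y) ≤ wordLength a x + wordLength a y := by
  rw [wordLength, map_mul]
  exact FreeGroup.norm_mul_le _ _

theorem wordLength_inv (x : A) : wordLength a x⁻¹ = wordLength a x := by
  rw [wordLength, map_inv, FreeGroup.norm_inv_eq, wordLength]

theorem wordLength_one : wordLength a 1 = 0 := by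
  rw [wordLength, map_one, FreeGroup.norm_one]

theorem wordLength_generator (i : Fin n) : wordLength a (a i) = 1 := by
  rw [wordLength, FreeGroupBasis.repr_apply_coe, FreeGroup.norm_of]

/-- The element of `A` spelled by a word. -/
def wordValue (L : List (Fin n × Bool)) : A := (L.map (letterValue a)).prod

theorem wordValue_cons (s : Fin n × Bool) (L : List (Fin n × Bool)) :
    wordValue a (s :: L) = letterValue a s * wordValue a L := by
  simp [wordValue]

theorem repr_wordValue (L : List (Fin n × Bool)) : a.repr (wordValue a L) = FreeGroup.mk L := by
  induction L with
  | nil => simp [wordValue, FreeGroup.one_eq_mk]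
  | cons s L ih =>
    have hs : a.repr (letterValue a s) = FreeGroup.mk [s] := by
      obtain ⟨i, b⟩ := s
      cases b
      · simp [letterValue, FreeGroup.of, FreeGroup.inv_mk, FreeGroup.invRev]
      · simp [letterValue, FreeGroup.of]
    rw [wordValue_cons, map_mul, ih, hs, FreeGroup.mul_mk]
    rfl

theorem wordLength_wordValue_le (L : List (Fin n × Bool)) :
    wordLength a (wordValue a L) ≤ L.length := by
  rw [wordLength, repr_wordValue]
  exact FreeGroup.norm_mk_le

theorem exists_wordValue_eq (x : A) :
    ∃ L : List (Fin n × Bool), wordValue a L = x ∧ L.length = wordLength a x := by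
  refine ⟨(a.repr x).toWord, a.repr.injective ?_, rfl⟩
  rw [repr_wordValue, FreeGroup.mk_toWord]

theorem wordValue_range_map (c : ℕ → Fin n × Bool) (m : ℕ) :
    wordValue a ((List.range m).map c) = subwordValue a c 0 m := by
  simp [wordValue, subwordValue, Function.comp_def]

theorem subwordValue_add (c : ℕ → Fin n × Bool) (p l k : ℕ) :
    subwordValue a c p (l + k) = subwordValue a c p l * subwordValue a c (p + l) k := by
  simp [subwordValue, List.range_add, Function.comp_def, add_assoc]

theorem wordLength_subwordValue_le (c : ℕ → Fin n × Bool) (p l : ℕ) :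
    wordLength a (subwordValue a c p l) ≤ l := by
  have := wordLength_wordValue_le a ((List.range l).map fun j => c (p + j))
  rwa [List.length_map, List.length_range, wordValue, List.map_map] at this

/-- Initial segments of a reduced infinite word are reduced lists, and nothing cancels in them. -/
theorem wordLength_initial_eq {c : ℕ → Fin n × Bool} (hc : IsReducedInfiniteWord c) (m : ℕ) :
    wordLength a (subwordValue a c 0 m) = m := by
  have hred : FreeGroup.IsReduced ((List.range m).map c) := by
    rw [FreeGroup.IsReduced, List.isChain_map, List.isChain_range]
    intro k _ h1
    by_contra h2
    refine hc k (Prod.ext h1.symm ?_)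
    revert h2
    cases (c k).2 <;> cases (c (k + 1)).2 <;> simp
  rw [← wordValue_range_map, wordLength, repr_wordValue, FreeGroup.norm, FreeGroup.toWord_mk,
    hred.reduce_eq, List.length_map, List.length_range]

theorem wordLength_le_of_adj {x y : A} (z : A) (h : (mulCayley (Set.range a)).Adj x y) :
    wordLength a (z * x) ≤ wordLength a (z * y) + 1 := by
  obtain ⟨-, _, ⟨i, rfl⟩, h⟩ := (mulCayley_adj' _ _ _).1 h
  rcases h with h | h
  · have : z * x = z * y * (a i)⁻¹ := by rw [← h]; group
    rw [this]
    refine (wordLength_mul_le a _ _).trans ?_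
    rw [wordLength_inv, wordLength_generator]
  · have : z * x = z * y * a i := by rw [h]; group
    rw [this]
    refine (wordLength_mul_le a _ _).trans ?_
    rw [wordLength_generator]

end WordLength

namespace SimpleGraph.Realization

variable {V : Type u} {Γ : SimpleGraph V}

/-- The affine extension to the realization of a function on the vertices. -/
noncomputable def extend (f : V → ℝ) (p : Γ.Realization) : ℝ := ∑ᶠ z, p.1 z * f z

theorem extend_eq (f : V → ℝ) {p : Γ.Realization} {x y : V} (hxy : x ≠ y)
    (hp : p.1 ∈ realizedEdge x y) : extend f p = p.1 x * f x + (1 - p.1 x) * f y := by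
  classical
  obtain ⟨h1, h2⟩ := realizedEdge_apply hxy hp
  rw [extend, finsum_eq_sum_of_support_subset (s := {x, y}), Finset.sum_pair hxy, h1]
  intro z hz
  by_contra hz'
  simp only [Finset.coe_insert, Finset.coe_singleton, mem_insert_iff, mem_singleton_iff,
    not_or] at hz'
  exact hz (by simp [h2 z hz'.1 hz'.2])

theorem extend_vertex (f : V → ℝ) (x : V) : extend f (vertex Γ x) = f x := by
  classical
  rw [extend, finsum_eq_single _ x]
  · simp [vertex]
  · intro z hz
    simp [vertex, hz]

/-- The affine extension of a function with increments at most 1 along edges is 1-Lipschitz. Such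
functions provide the lower bounds for distances. -/
theorem IsString.extend_sub_le {f : V → ℝ} (hf : ∀ x y, Γ.Adj x y → |f x - f y| ≤ 1)
    {p q : Γ.Realization} {ℓ : ℝ} (h : IsString p q ℓ) : extend f q - extend f p ≤ ℓ := by
  induction h with
  | nil p => simp
  | @cons p q r x y ℓ hxy hp hq _ ih =>
    have h1 : extend f q - extend f p = (f x - f y) * (q.1 x - p.1 x) := by
      rw [extend_eq f hxy.ne hp, extend_eq f hxy.ne hq]
      ring
    have h2 : extend f q - extend f p ≤ |p.1 x - q.1 x| := by
      rw [h1, abs_sub_comm]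
      refine (le_abs_self _).trans ?_
      rw [abs_mul]
      exact mul_le_of_le_one_left (abs_nonneg _) (hf x y hxy)
    linarith

theorem extend_sub_le_dist [Fact Γ.Connected] {f : V → ℝ}
    (hf : ∀ x y, Γ.Adj x y → |f x - f y| ≤ 1) (p q : Γ.Realization) :
    extend f q - extend f p ≤ Dist.dist p q :=
  le_csInf (exists_isString (Fact.out : Γ.Connected) p q) fun _ h => h.extend_sub_le hf

theorem dist_le_of_mem_realizedEdge [Fact Γ.Connected] {p q : Γ.Realization} {x y : V}
    (hxy : Γ.Adj x y) (hp : p.1 ∈ realizedEdge x y) (hq : q.1 ∈ realizedEdge x y) :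
    Dist.dist p q ≤ |p.1 x - q.1 x| := by
  have h := IsString.cons hxy hp hq (.nil q)
  rw [add_zero] at h
  exact csInf_le ⟨0, fun _ h => h.nonneg⟩ h

end SimpleGraph.Realization

section CayleyTreeDist

open SimpleGraph Realization

variable {A : Type u} [Group A] {n : ℕ} (a : FreeGroupBasis (Fin n) A)

theorem abs_wordLength_sub_le (z : A) (x y : A) (h : (mulCayley (Set.range a)).Adj x y) :
    |(wordLength a (z * x) : ℝ) - wordLength a (z * y)| ≤ 1 := by
  have h1 : (wordLength a (z * x) : ℝ) ≤ wordLength a (z * y) + 1 := by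
    exact_mod_cast wordLength_le_of_adj a z h
  have h2 : (wordLength a (z * y) : ℝ) ≤ wordLength a (z * x) + 1 := by
    exact_mod_cast wordLength_le_of_adj a z h.symm
  rw [abs_le]
  constructor <;> linarith

theorem adj_mul_letterValue (x : A) (s : Fin n × Bool) :
    (mulCayley (Set.range a)).Adj x (x * letterValue a s) := by
  have hne : x ≠ x * letterValue a s := by
    intro h
    have h1 : letterValue a s = 1 := by simpa using h
    have h2 : wordLength a (letterValue a s) = 1 := by
      rw [letterValue]
      split_ifs
      · exact wordLength_generator a s.1
      · rw [wordLength_inv, wordLength_generator]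
    rw [h1, wordLength_one] at h2
    exact zero_ne_one h2
  refine (mulCayley_adj' _ _ _).2 ⟨hne, a s.1, ⟨s.1, rfl⟩, ?_⟩
  rw [letterValue]
  split_ifs
  · exact Or.inl rfl
  · exact Or.inr (by group)

theorem dist_vertex_mul_wordValue_le (x : A) (L : List (Fin n × Bool)) :
    dist (vertex (mulCayley (Set.range a)) x) (vertex _ (x * wordValue a L)) ≤ L.length := by
  classical
  induction L generalizing x with
  | nil => simp [wordValue]
  | cons s L ih =>
    have hadj := adj_mul_letterValue a x s
    have h1 : dist (vertex (mulCayley (Set.range a)) x) (vertex _ (x * letterValue a s)) ≤ 1 := by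
      refine (dist_le_of_mem_realizedEdge (p := vertex _ x) (q := vertex _ _) hadj (left_mem_segment ℝ _ _)
        (right_mem_segment ℝ _ _)).trans ?_
      simp only [vertex, Pi.single_apply]
      rw [if_neg hadj.ne]
      simp
    have h2 := ih (x * letterValue a s)
    rw [mul_assoc, ← wordValue_cons] at h2
    have h3 := dist_triangle (vertex (mulCayley (Set.range a)) x)
      (vertex _ (x * letterValue a s)) (vertex _ (x * wordValue a (s :: L)))
    rw [List.length_cons, Nat.cast_add, Nat.cast_one]
    linarith

/-- The reduced word of `x⁻¹ * y` spells a path of that length, and the 1-Lipschitz function `z ↦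
wordLength a (x⁻¹ * z)` shows that no string is shorter. -/
theorem dist_vertex (x y : A) :
    dist (vertex (mulCayley (Set.range a)) x) (vertex _ y) = wordLength a (x⁻¹ * y) := by
  apply le_antisymm
  · obtain ⟨L, hL, hlen⟩ := exists_wordValue_eq a (x⁻¹ * y)
    have := dist_vertex_mul_wordValue_le a x L
    rwa [hL, hlen, mul_inv_cancel_left] at this
  · have := extend_sub_le_dist (abs_wordLength_sub_le a x⁻¹)
      (vertex (mulCayley (Set.range a)) x) (vertex _ y)
    rw [extend_vertex, extend_vertex, inv_mul_cancel, wordLength_one] at this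
    simpa using this

end CayleyTreeDist

/-! ## Words with many commutators -/

section Commutators

variable {A : Type u} [Group A] {n : ℕ} (a : FreeGroupBasis (Fin n) A) {c : ℕ → Fin n × Bool}
  {H : Type v} [Group H] {φ : A →* H}

theorem map_commutatorSet_eq_one (hφ : ∀ x ∈ φ.range, ∀ y ∈ φ.range, x * y = y * x) {x : A}
    (hx : x ∈ commutatorSet A) : φ x = 1 := by
  obtain ⟨y, z, rfl⟩ := hx
  rw [map_commutatorElement, commutatorElement_eq_one_iff_mul_comm]
  exact hφ _ ⟨y, rfl⟩ _ ⟨z, rfl⟩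

/-- Deleting commutators shortens the initial subwords by an arbitrary amount, without changing
their values in an abelian quotient. -/
theorem exists_shortened (hφ : ∀ x ∈ φ.range, ∀ y ∈ φ.range, x * y = y * x)
    (hc : ContainsInfinitelyManyCommutators a c) (k : ℕ) :
    ∃ (m : ℕ) (u : A), φ (subwordValue a c 0 m) = φ u ∧ wordLength a u + k ≤ m := by
  set I := {s : ℕ × ℕ | 0 < s.2 ∧ subwordValue a c s.1 s.2 ∈ commutatorSet A} with hI
  have hφI : ∀ p l, (p, l) ∈ I → φ (subwordValue a c p l) = 1 := fun p l h =>
    map_commutatorSet_eq_one hφ h.2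
  -- If infinitely many commutators start at one position, their lengths are unbounded and deleting
  -- a single one suffices. Otherwise the starting positions are unbounded, and `k` disjoint
  -- commutators are deleted one by one.
  by_cases hfib : ∃ p, {s ∈ I | s.1 = p}.Infinite
  · obtain ⟨p, hp⟩ := hfib
    have hinj : Set.InjOn Prod.snd {s ∈ I | s.1 = p} := by
      rintro ⟨p₁, l₁⟩ ⟨-, h₁⟩ ⟨p₂, l₂⟩ ⟨-, h₂⟩ h
      exact Prod.ext (h₁.trans h₂.symm) h
    obtain ⟨_, ⟨⟨q, l⟩, ⟨hl, hq⟩, rfl⟩, hkl⟩ := (hp.image hinj).exists_gt k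
    obtain rfl : q = p := hq
    refine ⟨q + l, subwordValue a c 0 q, ?_, ?_⟩
    · rw [subwordValue_add, map_mul, zero_add, hφI q l hl, mul_one]
    · have := wordLength_subwordValue_le a c 0 q
      dsimp only at hkl
      omega
  · push Not at hfib
    have hfst : (Prod.fst '' I).Infinite := fun hfin =>
      hc (Set.Finite.of_finite_fibers Prod.fst hfin fun p _ =>
        (hfib p).subset fun _ hs => hs)
    induction k with
    | zero => exact ⟨0, subwordValue a c 0 0, rfl, by simpa using wordLength_subwordValue_le a c 0 0⟩
    | succ k ih =>
      obtain ⟨m, u, hu, hk⟩ := ih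
      -- The new commutator starts beyond the part already shortened, and its deletion gains at
      -- least one letter.
      obtain ⟨_, ⟨⟨p, l⟩, hpl, rfl⟩, hp⟩ := hfst.exists_gt m
      dsimp only at hp
      have hl : 0 < l := hpl.1
      obtain ⟨d, rfl⟩ := Nat.exists_eq_add_of_le hp.le
      refine ⟨m + d + l, u * subwordValue a c m d, ?_, ?_⟩
      · rw [subwordValue_add, subwordValue_add, map_mul, map_mul, zero_add, zero_add,
          hφI _ l hpl, mul_one, map_mul, hu]
      · have h1 := wordLength_mul_le a u (subwordValue a c m d)
        have h2 := wordLength_subwordValue_le a c m d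
        omega

end Commutators

/-! ### Chains of elements of the semidirect product over a horoball -/

section ChainsInSemidirectProduct

open SimpleGraph Realization

variable {A : Type u} [Group A] {B : Type v} [Group B] {n : ℕ} {a : FreeGroupBasis (Fin n) A}
  {φ : A →* MulAut B} {c : ℕ → Fin n × Bool} {σ : GeodesicRay (CayleyTree a)}

theorem vertex_mem_horoball_of_wordLength
    (hσ : ∀ m : ℕ, σ (m : ℝ≥0) = vertex _ (subwordValue a c 0 m)) {t : ℝ} {x : A} {m : ℕ}
    (hm : wordLength a (x⁻¹ * subwordValue a c 0 m) + t ≤ m) :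
    vertex _ x ∈ σ.horoball t := by
  refine ⟨m, ?_, ?_⟩
  · have : (0 : ℝ) ≤ wordLength a (x⁻¹ * subwordValue a c 0 m) := Nat.cast_nonneg _
    rw [NNReal.coe_natCast]
    linarith
  · rw [hσ, dist_vertex, NNReal.coe_natCast]
    linarith

/-- Going from `σ l` on to `σ m` adds `m - l` to both sides of the estimate. Hence two points of a
horoball can be compared with the same vertex of the ray. -/
theorem eventually_wordLength_of_vertex_mem_horoball
    (hσ : ∀ m : ℕ, σ (m : ℝ≥0) = vertex _ (subwordValue a c 0 m)) {t : ℝ} {x : A}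
    (hx : vertex _ x ∈ σ.horoball t) :
    ∀ᶠ m : ℕ in Filter.atTop, wordLength a (x⁻¹ * subwordValue a c 0 m) + t ≤ m := by
  obtain ⟨l, hl, hd⟩ := hx
  filter_upwards [Filter.eventually_ge_atTop ⌈l⌉₊] with m hm
  have hlm : (l : ℝ) ≤ m := by exact_mod_cast (Nat.le_ceil l).trans (by exact_mod_cast hm)
  have h1 : dist (σ l) (σ (m : ℝ≥0)) = m - l := by
    rw [σ.isometry.dist_eq, NNReal.dist_eq, NNReal.coe_natCast, abs_sub_comm,
      abs_of_nonneg (by linarith)]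
  have h2 := dist_triangle (vertex _ x) (σ l) (σ (m : ℝ≥0))
  rw [h1, hσ, dist_vertex] at h2
  linarith

/-- The steps by generators of `A` and by the elements of `F ⊆ B`. -/
def stepSet (a : FreeGroupBasis (Fin n) A) (φ : A →* MulAut B) (F : Set B) : Set (B ⋊[φ] A) :=
  range (fun s => SemidirectProduct.inr (letterValue a s)) ∪ SemidirectProduct.inl '' F

theorem semidirectAction_vertex_one (g : B ⋊[φ] A) :
    CayleyTree.semidirectAction a φ g (vertex _ 1) = vertex _ g.right := by
  change CayleyTree.translate a g.right (vertex _ 1) = _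
  rw [CayleyTree.translate_vertex, mul_one]

theorem horoStep_iff {F : Set B} {t : ℝ} {g g' : B ⋊[φ] A} :
    HoroStep (CayleyTree.semidirectAction a φ) σ (vertex _ 1) (stepSet a φ F) t g g' ↔
      vertex _ g.right ∈ σ.horoball t ∧ vertex _ g'.right ∈ σ.horoball t ∧
        g⁻¹ * g' ∈ stepSet a φ F := by
  rw [HoroStep, semidirectAction_vertex_one, semidirectAction_vertex_one]

/-- Inside a horoball one moves along the tree to the ray, with the `B`-coordinate fixed. -/
theorem eqvGen_horoStep_initial
    (hσ : ∀ m : ℕ, σ (m : ℝ≥0) = vertex _ (subwordValue a c 0 m)) (F : Set B) {t : ℝ} {x : A}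
    {m : ℕ} (hm : wordLength a (x⁻¹ * subwordValue a c 0 m) + t ≤ m) (b : B) :
    Relation.EqvGen
      (HoroStep (CayleyTree.semidirectAction a φ) σ (vertex _ 1) (stepSet a φ F) t)
      ⟨b, x⟩ ⟨b, subwordValue a c 0 m⟩ := by
  -- Each letter read shortens the remaining word by one, so every vertex on the way is within `m -
  -- t` of the ray point at `m` and stays in the horoball.
  have key : ∀ (L : List (Fin n × Bool)) (x : A), x * wordValue a L = subwordValue a c 0 m →
      L.length + t ≤ m → Relation.EqvGen
        (HoroStep (CayleyTree.semidirectAction a φ) σ (vertex _ 1) (stepSet a φ F) t)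
        ⟨b, x⟩ ⟨b, subwordValue a c 0 m⟩ := by
    intro L
    induction L with
    | nil =>
      intro x hx _
      rw [← hx]
      simpa [wordValue] using Relation.EqvGen.refl _
    | cons s L ih =>
      intro x hx hL
      have hmem : ∀ (L : List (Fin n × Bool)) (x : A), x * wordValue a L = subwordValue a c 0 m →
          L.length + t ≤ m → vertex _ x ∈ σ.horoball t := by
        intro L x hx hL
        refine vertex_mem_horoball_of_wordLength hσ (m := m) ?_
        rw [← hx, inv_mul_cancel_left]
        have : (wordLength a (wordValue a L) : ℝ) ≤ L.length := by
          exact_mod_cast wordLength_wordValue_le a L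
        linarith
      have hx' : x * letterValue a s * wordValue a L = subwordValue a c 0 m := by
        rw [mul_assoc, ← wordValue_cons, hx]
      have hL' : (L.length : ℝ) + t ≤ m := by
        rw [List.length_cons, Nat.cast_add, Nat.cast_one] at hL
        linarith
      refine .trans _ _ _ (.rel _ _ (horoStep_iff.2 ⟨hmem _ _ hx hL, hmem _ _ hx' hL', ?_⟩))
        (ih _ hx' hL')
      refine Or.inl ⟨s, ?_⟩
      ext <;> simp
  obtain ⟨L, hL, hlen⟩ := exists_wordValue_eq a (x⁻¹ * subwordValue a c 0 m)
  refine key L x (by rw [hL, mul_inv_cancel_left]) ?_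
  rwa [hlen]

theorem eqvGen_horoStep_of_left_eq
    (hσ : ∀ m : ℕ, σ (m : ℝ≥0) = vertex _ (subwordValue a c 0 m)) (F : Set B) {t : ℝ} {x y : A}
    (hx : vertex _ x ∈ σ.horoball t) (hy : vertex _ y ∈ σ.horoball t) (b : B) :
    Relation.EqvGen
      (HoroStep (CayleyTree.semidirectAction a φ) σ (vertex _ 1) (stepSet a φ F) t)
      ⟨b, x⟩ ⟨b, y⟩ := by
  obtain ⟨m, hm, hm'⟩ := ((eventually_wordLength_of_vertex_mem_horoball hσ hx).and
    (eventually_wordLength_of_vertex_mem_horoball hσ hy)).exists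
  exact (eqvGen_horoStep_initial hσ F hm b).trans _ _ _
    ((eqvGen_horoStep_initial hσ F hm' b).symm _ _)

/-- Every value of `φ` is attained arbitrarily deep inside the horoballs. -/
theorem exists_mem_horoball_map_eq (hφ : ∀ x ∈ φ.range, ∀ y ∈ φ.range, x * y = y * x)
    (hc : ContainsInfinitelyManyCommutators a c)
    (hσ : ∀ m : ℕ, σ (m : ℝ≥0) = vertex _ (subwordValue a c 0 m)) (t : ℝ) (u : A) :
    ∃ x : A, vertex _ x ∈ σ.horoball t ∧ φ x = φ u := by
  obtain ⟨m, y, hy, hm⟩ := exists_shortened a hφ hc (⌈t⌉₊ + wordLength a u)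
  -- The first two factors cancel under `φ`, and the distance to the ray point at `m` is the length
  -- of `u⁻¹ * y`, at most `m - ⌈t⌉₊`.
  refine ⟨subwordValue a c 0 m * y⁻¹ * u, vertex_mem_horoball_of_wordLength hσ (m := m) ?_, ?_⟩
  · have h1 : (subwordValue a c 0 m * y⁻¹ * u)⁻¹ * subwordValue a c 0 m = u⁻¹ * y := by group
    have h2 := wordLength_mul_le a u⁻¹ y
    rw [wordLength_inv] at h2
    have h3 : (wordLength a (u⁻¹ * y) : ℝ) + ⌈t⌉₊ ≤ m := by
      exact_mod_cast (by omega : wordLength a (u⁻¹ * y) + ⌈t⌉₊ ≤ m)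
    have h4 := Nat.le_ceil t
    rw [h1]
    linarith
  · rw [map_mul, map_mul, map_inv, hy, mul_inv_cancel, one_mul]

/-- Over a fixed vertex `z` of the horoball, the right multiplications of the `B`-coordinate that
chains can realize form a subgroup `H` of `B`. It is all of `B` because it contains every `φ u
s.left`. -/
theorem eqvGen_horoStep (hφ : ∀ x ∈ φ.range, ∀ y ∈ φ.range, x * y = y * x)
    (hc : ContainsInfinitelyManyCommutators a c)
    (hσ : ∀ m : ℕ, σ (m : ℝ≥0) = vertex _ (subwordValue a c 0 m)) {S : Set (B ⋊[φ] A)}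
    (hS : Subgroup.closure S = ⊤) {t : ℝ} {g g' : B ⋊[φ] A}
    (hg : vertex _ g.right ∈ σ.horoball t) (hg' : vertex _ g'.right ∈ σ.horoball t) :
    Relation.EqvGen (HoroStep (CayleyTree.semidirectAction a φ) σ (vertex _ 1)
      (stepSet a φ (SemidirectProduct.left '' S)) t) g g' := by
  set R := Relation.EqvGen (HoroStep (CayleyTree.semidirectAction a φ) σ (vertex _ 1)
      (stepSet a φ (SemidirectProduct.left '' S)) t) with hR
  obtain ⟨z, hz⟩ : ∃ z : A, vertex _ z ∈ σ.horoball t := ⟨_, hg⟩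
  have move : ∀ {x y : A}, vertex _ x ∈ σ.horoball t → vertex _ y ∈ σ.horoball t → ∀ b : B,
      R ⟨b, x⟩ ⟨b, y⟩ := fun hx hy b => eqvGen_horoStep_of_left_eq hσ _ hx hy b
  let H : Subgroup B :=
    { carrier := {d | ∀ b : B, R ⟨b, z⟩ ⟨b * d, z⟩}
      one_mem' := fun b => by rw [mul_one]; exact .refl _
      mul_mem' := fun {d d'} hd hd' b => by
        rw [← mul_assoc]
        exact (hd b).trans _ _ _ (hd' _)
      inv_mem' := fun {d} hd b => by
        have := hd (b * d⁻¹)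
        rw [inv_mul_cancel_right] at this
        exact this.symm _ _ }
  -- Travel from `z` to some `x` in the horoball with `φ x = φ u`, step there by `s.left`, which
  -- multiplies `b` by `φ x s.left`, and travel back.
  have hHS : ∀ s ∈ S, ∀ u : A, φ u s.left ∈ H := by
    intro s hs u b
    obtain ⟨x, hx, hxu⟩ := exists_mem_horoball_map_eq hφ hc hσ t u
    refine (move hz hx b).trans _ _ _ (.trans _ _ _ (.rel _ _ ?_) (move hx hz _))
    refine horoStep_iff.2 ⟨hx, hx, Or.inr ⟨s.left, mem_image_of_mem _ hs, ?_⟩⟩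
    rw [eq_inv_mul_iff_mul_eq, ← hxu]
    ext <;> simp
  -- Quantifying over all `u` makes the induction close up: the twist by `g.right` in the
  -- `B`-coordinate of a product or an inverse is absorbed into `u`.
  have hH : ∀ g : B ⋊[φ] A, ∀ u : A, φ u g.left ∈ H := by
    intro g
    have hg : g ∈ Subgroup.closure S := by rw [hS]; trivial
    induction hg using Subgroup.closure_induction with
    | mem s hs => exact hHS s hs
    | one => intro u; simp [H.one_mem]
    | mul g g' _ _ ih ih' =>
      intro u
      have h2 := ih' (u * g.right)
      rw [SemidirectProduct.mul_left, map_mul]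
      refine H.mul_mem (ih u) ?_
      rwa [map_mul, MulAut.mul_apply] at h2
    | inv g _ ih =>
      intro u
      have h2 := H.inv_mem (ih (u * g.right⁻¹))
      rw [map_mul, MulAut.mul_apply, ← map_inv, ← map_inv] at h2
      simpa using h2
  have h1 := hH ⟨g.left⁻¹ * g'.left, 1⟩ 1 g.left
  rw [map_one, MulAut.one_apply, mul_inv_cancel_left] at h1
  exact (move hg hz g.left).trans _ _ _ (h1.trans _ _ _ (move hz hg' g'.left))

theorem mem_sigmaOne_of_isRepresentedBy (hG : Group.FG (B ⋊[φ] A))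
    (hφ : ∀ x ∈ φ.range, ∀ y ∈ φ.range, x * y = y * x) {e : GeodesicBoundary (CayleyTree a)}
    (he : IsRepresentedBy a e c) (hc : ContainsInfinitelyManyCommutators a c) :
    e ∈ SigmaOne.{w} (CayleyTree.semidirectAction a φ) := by
  obtain ⟨-, σ, rfl, hσ⟩ := he
  obtain ⟨S, hS, hSfin⟩ := Group.fg_iff.1 hG
  refine mem_sigmaOne_of_horoStep (o := vertex _ 1)
    (K := stepSet a φ (SemidirectProduct.left '' S)) ?_ fun t g g' hg hg' => ?_
  · exact (finite_range _).union ((hSfin.image _).image _)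
  · rw [semidirectAction_vertex_one] at hg hg'
    exact eqvGen_horoStep hφ hc hσ hS hg hg'

end ChainsInSemidirectProduct

/-! ## The geodesic ray along an infinite reduced word -/

section WordRay

open SimpleGraph Realization

variable {A : Type u} [Group A] {n : ℕ} (a : FreeGroupBasis (Fin n) A) (c : ℕ → Fin n × Bool)

theorem floor_le_coe (s : ℝ≥0) : (⌊s⌋₊ : ℝ) ≤ s := by
  have : ((⌊s⌋₊ : ℝ≥0) : ℝ) ≤ s := NNReal.coe_le_coe.2 (Nat.floor_le zero_le)
  rwa [NNReal.coe_natCast] at this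

theorem coe_lt_floor_add_one (s : ℝ≥0) : (s : ℝ) < ⌊s⌋₊ + 1 := by
  exact_mod_cast Nat.lt_floor_add_one s

theorem adj_subwordValue_succ (m : ℕ) : (mulCayley (Set.range a)).Adj (subwordValue a c 0 m)
    (subwordValue a c 0 (m + 1)) := by
  have h : subwordValue a c 0 (m + 1) = subwordValue a c 0 m * letterValue a (c m) := by
    rw [subwordValue_add, zero_add]
    simp [subwordValue]
  rw [h]
  exact adj_mul_letterValue a _ _

open Classical in
/-- The point at parameter `s` of the path from `1` through the vertices spelled by the initial
subwords of `c`. -/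
noncomputable def wordRayPoint (s : ℝ≥0) : CayleyTree a :=
  ⟨(1 - ((s : ℝ) - ⌊s⌋₊)) • Pi.single (subwordValue a c 0 ⌊s⌋₊) 1 +
      ((s : ℝ) - ⌊s⌋₊) • Pi.single (subwordValue a c 0 (⌊s⌋₊ + 1)) 1, _, _,
    Or.inr (adj_subwordValue_succ a c ⌊s⌋₊), _, _, by linarith [coe_lt_floor_add_one s],
    by linarith [floor_le_coe s], by ring, rfl⟩

theorem wordRayPoint_mem (s : ℝ≥0) : (wordRayPoint a c s).1 ∈
    realizedEdge (subwordValue a c 0 ⌊s⌋₊) (subwordValue a c 0 (⌊s⌋₊ + 1)) :=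
  ⟨_, _, by have := coe_lt_floor_add_one s; linarith, by have := floor_le_coe s; linarith,
    by ring, rfl⟩

theorem wordRayPoint_apply (s : ℝ≥0) :
    (wordRayPoint a c s).1 (subwordValue a c 0 ⌊s⌋₊) = 1 - ((s : ℝ) - ⌊s⌋₊) := by
  classical
  simp [wordRayPoint, (adj_subwordValue_succ a c ⌊s⌋₊).ne]

theorem dist_wordRayPoint_floor (s : ℝ≥0) :
    dist (wordRayPoint a c s) (vertex _ (subwordValue a c 0 ⌊s⌋₊)) ≤ s - ⌊s⌋₊ := by
  refine (dist_le_of_mem_realizedEdge (q := vertex _ _) (adj_subwordValue_succ a c ⌊s⌋₊)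
    (wordRayPoint_mem a c s) (left_mem_segment ℝ _ _)).trans ?_
  rw [wordRayPoint_apply]
  have := floor_le_coe s
  simp only [vertex, Pi.single_eq_same]
  rw [abs_le]
  constructor <;> linarith

theorem dist_wordRayPoint_floor_add_one (s : ℝ≥0) :
    dist (wordRayPoint a c s) (vertex _ (subwordValue a c 0 (⌊s⌋₊ + 1))) ≤ ⌊s⌋₊ + 1 - s := by
  classical
  refine (dist_le_of_mem_realizedEdge (q := vertex _ _) (adj_subwordValue_succ a c ⌊s⌋₊)
    (wordRayPoint_mem a c s) (right_mem_segment ℝ _ _)).trans ?_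
  rw [wordRayPoint_apply]
  have := coe_lt_floor_add_one s
  simp only [vertex, Pi.single_apply, if_neg (adj_subwordValue_succ a c ⌊s⌋₊).ne]
  rw [abs_le]
  constructor <;> linarith

theorem dist_subwordValue_le {m k : ℕ} (hmk : m ≤ k) :
    dist (vertex (mulCayley (Set.range a)) (subwordValue a c 0 m))
      (vertex _ (subwordValue a c 0 k)) ≤ k - m := by
  obtain ⟨d, rfl⟩ := Nat.exists_eq_add_of_le hmk
  rw [dist_vertex, subwordValue_add, inv_mul_cancel_left]
  push_cast
  rw [add_sub_cancel_left]
  exact_mod_cast wordLength_subwordValue_le a c _ d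

theorem dist_wordRayPoint_le {s t : ℝ≥0} (hst : s ≤ t) :
    dist (wordRayPoint a c s) (wordRayPoint a c t) ≤ t - s := by
  rcases (Nat.floor_mono hst).eq_or_lt with h | h
  · have h1 := wordRayPoint_mem a c t
    have h2 := wordRayPoint_apply a c t
    rw [← h] at h1 h2
    refine (dist_le_of_mem_realizedEdge (adj_subwordValue_succ a c ⌊s⌋₊)
      (wordRayPoint_mem a c s) h1).trans ?_
    rw [h2, wordRayPoint_apply]
    have : (s : ℝ) ≤ t := hst
    rw [abs_le]
    constructor <;> linarith
  · have h1 := dist_wordRayPoint_floor_add_one a c s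
    have h2 := dist_subwordValue_le a c (Nat.succ_le_of_lt h)
    have h3 := dist_wordRayPoint_floor a c t
    rw [_root_.dist_comm] at h3
    have h4 := dist_triangle4 (wordRayPoint a c s) (vertex _ (subwordValue a c 0 (⌊s⌋₊ + 1)))
      (vertex _ (subwordValue a c 0 ⌊t⌋₊)) (wordRayPoint a c t)
    rw [Nat.succ_eq_add_one, Nat.cast_add, Nat.cast_one] at h2
    linarith

/-- As the word is reduced, word length increases by one along each edge of the path. This
1-Lipschitz function thus recovers the parameter, which makes the path geodesic. -/
theorem extend_wordLength_wordRayPoint {c : ℕ → Fin n × Bool} (hc : IsReducedInfiniteWord c)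
    (s : ℝ≥0) : extend (fun x => (wordLength a (1 * x) : ℝ)) (wordRayPoint a c s) = s := by
  rw [extend_eq _ (adj_subwordValue_succ a c ⌊s⌋₊).ne (wordRayPoint_mem a c s),
    wordRayPoint_apply, one_mul, one_mul, wordLength_initial_eq a hc, wordLength_initial_eq a hc]
  push_cast
  ring

/-- The geodesic ray from `1` along an infinite reduced word. -/
noncomputable def wordRay {c : ℕ → Fin n × Bool} (hc : IsReducedInfiniteWord c) :
    GeodesicRay (CayleyTree a) where
  toFun := wordRayPoint a c
  isometry := by
    have key : ∀ s t : ℝ≥0, s ≤ t →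
        dist (wordRayPoint a c s) (wordRayPoint a c t) = dist s t := by
      intro s t hst
      have hst' : (s : ℝ) ≤ t := hst
      rw [NNReal.dist_eq, abs_sub_comm, abs_of_nonneg (by linarith)]
      refine le_antisymm (dist_wordRayPoint_le a c hst) ?_
      have := extend_sub_le_dist (abs_wordLength_sub_le a 1) (wordRayPoint a c s)
        (wordRayPoint a c t)
      rwa [extend_wordLength_wordRayPoint a hc, extend_wordLength_wordRayPoint a hc] at this
    refine Isometry.of_dist_eq fun s t => ?_
    rcases le_total s t with h | h
    · exact key s t h
    · rw [_root_.dist_comm, key t s h, _root_.dist_comm]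

theorem isRepresentedBy_wordRay {c : ℕ → Fin n × Bool} (hc : IsReducedInfiniteWord c) :
    IsRepresentedBy a (wordRay a hc).endpoint c := by
  refine ⟨hc, _, rfl, fun m => ?_⟩
  have h := dist_wordRayPoint_floor a c m
  rw [Nat.floor_natCast, NNReal.coe_natCast, sub_self] at h
  exact dist_le_zero.1 h

/-- The infinite power of the commutator of the first two basis elements. -/
def commutatorWord (hn : 2 ≤ n) (m : ℕ) : Fin n × Bool :=
  (⟨m % 2, (Nat.mod_lt m two_pos).trans_le hn⟩, decide (m % 4 < 2))

theorem isReducedInfiniteWord_commutatorWord (hn : 2 ≤ n) :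
    IsReducedInfiniteWord (commutatorWord hn) := by
  intro m h
  -- Consecutive letters come from different generators, so they cannot be mutually inverse.
  have h1 : (m + 1) % 2 = m % 2 := congrArg (fun s : Fin n × Bool => (s.1 : ℕ)) h
  omega

theorem containsInfinitelyManyCommutators_commutatorWord (hn : 2 ≤ n) :
    ContainsInfinitelyManyCommutators a (commutatorWord hn) := by
  refine Set.infinite_of_injective_forall_mem (f := fun k : ℕ => (4 * k, 4))
    (fun k l h => by simpa using h) fun k => ⟨by simp, ?_⟩
  refine ⟨a ⟨0, by omega⟩, a ⟨1, by omega⟩, ?_⟩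
  have h0 : (4 * k) % 2 = 0 := by omega
  have h1 : (4 * k + 1) % 2 = 1 := by omega
  have h2 : (4 * k + 2) % 2 = 0 := by omega
  have h3 : (4 * k + 3) % 2 = 1 := by omega
  have k0 : (4 * k) % 4 = 0 := by omega
  have k1 : (4 * k + 1) % 4 = 1 := by omega
  have k2 : (4 * k + 2) % 4 = 2 := by omega
  have k3 : (4 * k + 3) % 4 = 3 := by omega
  simp only [subwordValue, commutatorWord, letterValue, List.range_succ, List.range_zero,
    List.nil_append, List.cons_append, List.map_cons, List.map_nil, List.prod_cons, List.prod_nil,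
    add_zero, h0, h1, h2, h3, k0, k1, k2, k3, commutatorElement_def]
  simp [mul_assoc]

end WordRay

theorem mainTheorem6 {A : Type u} [Group A] {B : Type v} [Group B] (n : ℕ)
    (hn : 2 ≤ n) (a : FreeGroupBasis (Fin n) A) (φ : A →* MulAut B)
    (hG : Group.FG (B ⋊[φ] A)) (hφ : ∀ x ∈ φ.range, ∀ y ∈ φ.range, x * y = y * x) :
    (SigmaOne.{w} (CayleyTree.semidirectAction a φ)).Nonempty ∧
      ∀ (e : GeodesicBoundary (CayleyTree a)) (c : ℕ → Fin n × Bool),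
        IsRepresentedBy a e c → ContainsInfinitelyManyCommutators a c →
          e ∈ SigmaOne.{w} (CayleyTree.semidirectAction a φ) := by
  have key : ∀ (e : GeodesicBoundary (CayleyTree a)) (c : ℕ → Fin n × Bool),
      IsRepresentedBy a e c → ContainsInfinitelyManyCommutators a c →
        e ∈ SigmaOne.{w} (CayleyTree.semidirectAction a φ) := fun _ _ he hc =>
    mem_sigmaOne_of_isRepresentedBy hG hφ he hc
  exact ⟨⟨_, key _ _ (isRepresentedBy_wordRay a (isReducedInfiniteWord_commutatorWord hn))
    (containsInfinitelyManyCommutators_commutatorWord a hn)⟩, key⟩
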